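/- Let $Y$ be a smooth $7$-manifold with a $G_2$ structure, i.e. a smooth $3$-form $\varphi$ which at every point is identified, by some linear isomorphism $T_yY\cong\mathbb R^7$, with the standard form $e^{123}+e^{145}+e^{167}+e^{246}-e^{257}-e^{347}-e^{356}$. Let $*$ be the Hodge star of the metric and orientation induced by $\varphi$, let $\psi=*\varphi$, and let $a\lrcorner\beta$ denote the contraction of a form $\beta$ with a $1$-form $a$, that is, insertion of the vector metrically dual to $a$ into the first slot of $\beta$. Let $\phi$ (the dilaton) and $f$ be smooth functions and $\widehat H$ a smooth $3$-form on $Y$. The heterotic $N=\tfrac12$ Killing spinor equations are $$d\varphi=2\,d\phi\wedge\varphi-*\widehat H-f\psi,\qquad d\psi=2\,d\phi\wedge\psi,\qquad *d\phi=-\tfrac12\widehat H\wedge\varphi,\qquad \tfrac12 *f=\widehat H\wedge\psi .$$ The torsion classes of the $G_2$ structure are the function $\tau_0$, the $1$-form $\tau_1$, the $2$-form $\tau_2$ and the $3$-form $\tau_3$ determined by $$d\varphi=\tau_0\psi+3\tau_1\wedge\varphi+*\tau_3,\qquad d\psi=4\tau_1\wedge\psi+*\tau_2,$$ where $\tau_2\wedge\psi=0$,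 $\varphi\wedge *\tau_3=0$ and $\tau_3\wedge\varphi=0$; the structure is integrable if $\tau_2=0$. (1) The Killing spinor equations hold if and only if $\widehat H=\tfrac1{14}f\varphi+H_\perp$ with $H_\perp\wedge\psi=0$ and $*H_\perp\wedge\varphi=0$, and the torsion classes are $$\tau_0=-\tfrac{15}{14}f,\qquad \tau_1=\tfrac12 d\phi,\qquad \tau_2=0,\qquad \tau_3=-H_\perp-\tfrac12 d\phi\lrcorner\psi,$$ where also $*\tau_3=-*H_\perp+\tfrac12 d\phi\wedge\varphi$. (2) If the Killing spinor equations and the Bianchi identities $d\widehat H=0$, $f=\text{constant}$ hold, then the flux equation of motion $d\left(*e^{-2\phi}\widehat H\right)=0$ holds. -/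

import Mathlib

open scoped Manifold ContDiff Nat

noncomputable section

namespace HetG2

/-! ### Multilinear algebra -/

section Algebra

variable {V : Type*} [AddCommGroup V] [Module ℝ V] [TopologicalSpace V]

theorem update_castAdd_left {k l : ℕ} [DecidableEq (Fin (k + l))] (v : Fin (k + l) → V)
    (a : Fin k) (x : V) :
    (fun i => Function.update v (Fin.castAdd l a) x (Fin.castAdd l i)) =
      Function.update (fun i => v (Fin.castAdd l i)) a x := by
  ext i
  by_cases h : i = a
  · subst h; simp
  · rw [Function.update_of_ne h, Function.update_of_ne (by simpa using h)]

theorem update_castAdd_right {k l : ℕ} [DecidableEq (Fin (k + l))] (v : Fin (k + l) → V)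
    (a : Fin k) (x : V) :
    (fun j => Function.update v (Fin.castAdd l a) x (Fin.natAdd k j)) =
      fun j => v (Fin.natAdd k j) := by
  ext j
  exact Function.update_of_ne (by intro h; simp [Fin.ext_iff] at h; omega) _ _

theorem update_natAdd_left {k l : ℕ} [DecidableEq (Fin (k + l))] (v : Fin (k + l) → V)
    (b : Fin l) (x : V) :
    (fun i => Function.update v (Fin.natAdd k b) x (Fin.castAdd l i)) =
      fun i => v (Fin.castAdd l i) := by
  ext i
  exact Function.update_of_ne (by intro h; simp [Fin.ext_iff] at h; omega) _ _

theorem update_natAdd_right {k l : ℕ} [DecidableEq (Fin (k + l))] (v : Fin (k + l) → V)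
    (b : Fin l) (x : V) :
    (fun j => Function.update v (Fin.natAdd k b) x (Fin.natAdd k j)) =
      Function.update (fun j => v (Fin.natAdd k j)) b x := by
  ext j
  by_cases h : j = b
  · subst h; simp
  · rw [Function.update_of_ne h, Function.update_of_ne (by simpa using h)]

/-- The tensor product `α ⊗ β` of two alternating forms, as a multilinear map:
`(v₁, …, v_{k+l}) ↦ α (v₁, …, v_k) * β (v_{k+1}, …, v_{k+l})`. -/
def tensor {k l : ℕ} (α : V [⋀^Fin k]→L[ℝ] ℝ) (β : V [⋀^Fin l]→L[ℝ] ℝ) :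
    ContinuousMultilinearMap ℝ (fun _ : Fin (k + l) => V) ℝ where
  toFun v := α (fun i => v (Fin.castAdd l i)) * β (fun j => v (Fin.natAdd k j))
  map_update_add' := by
    intro _ v i x y
    refine Fin.addCases (fun a => ?_) (fun b => ?_) i
    · simp only [update_castAdd_left, update_castAdd_right, ContinuousAlternatingMap.map_update_add,
        add_mul]
    · simp only [update_natAdd_left, update_natAdd_right, ContinuousAlternatingMap.map_update_add,
        mul_add]
  map_update_smul' := by
    intro _ v i c x
    refine Fin.addCases (fun a => ?_) (fun b => ?_) i
    · simp only [update_castAdd_left, update_castAdd_right, ContinuousAlternatingMap.map_update_smul,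
        smul_eq_mul, mul_assoc]
    · simp only [update_natAdd_left, update_natAdd_right, ContinuousAlternatingMap.map_update_smul,
        smul_eq_mul, mul_left_comm]
  cont := by
    refine Continuous.mul (α.cont.comp ?_) (β.cont.comp ?_) <;> fun_prop

/-- The wedge product, normalised so that
`(α ∧ β)(v) = 1 / (k! l!) ∑_σ sign σ α(v_{σ 1}, …, v_{σ k}) β(v_{σ (k+1)}, …, v_{σ (k+l)})`. -/
def wedge {k l : ℕ} (α : V [⋀^Fin k]→L[ℝ] ℝ) (β : V [⋀^Fin l]→L[ℝ] ℝ) :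
    V [⋀^Fin (k + l)]→L[ℝ] ℝ :=
  ((k ! : ℝ) * (l ! : ℝ))⁻¹ • ContinuousMultilinearMap.alternatization (tensor α β)

end Algebra

/-- The model space `ℝ⁷`. -/
abbrev E7 : Type := EuclideanSpace ℝ (Fin 7)

/-- The standard basis vectors of `ℝ⁷`, indexed from `0` to `6`. -/
def basisVec (i : Fin 7) : E7 := EuclideanSpace.single i 1

/-- The coordinate one-form `e^i` on `ℝ⁷`. -/
def dx (i : Fin 7) : E7 [⋀^Fin 1]→L[ℝ] ℝ :=
  ContinuousAlternatingMap.ofSubsingleton ℝ E7 ℝ 0 (EuclideanSpace.proj i)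

/-- The monomial three-form `e^{ijk} = e^i ∧ e^j ∧ e^k` on `ℝ⁷`. -/
def dx3 (i j k : Fin 7) : E7 [⋀^Fin 3]→L[ℝ] ℝ := wedge (wedge (dx i) (dx j)) (dx k)

/-- The standard `G₂` three-form on `ℝ⁷`; with coordinates numbered from `1` it is
`e^{123} + e^{145} + e^{167} + e^{246} - e^{257} - e^{347} - e^{356}`,
that is `e^1 ∧ ω + Re Ψ` with `ω = e^{23} + e^{45} + e^{67}` and
`Ψ = (e^2 + i e^3) ∧ (e^4 + i e^5) ∧ (e^6 + i e^7)`. -/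
def phi0 : E7 [⋀^Fin 3]→L[ℝ] ℝ :=
  dx3 0 1 2 + dx3 0 3 4 + dx3 0 5 6 + dx3 1 3 5 - dx3 1 4 6 - dx3 2 3 6 - dx3 2 4 5

/-- The standard volume form of `ℝ⁷` evaluated on seven vectors. -/
def vol0 (v : Fin 7 → E7) : ℝ := Matrix.det (Matrix.of fun i j => v i j)

theorem append_update {k q : ℕ} (h : k + q = 7) [DecidableEq (Fin q)] (u : Fin k → E7)
    (w : Fin q → E7) (b : Fin q) (x : E7) :
    (fun m => Fin.append u (Function.update w b x) (Fin.cast h.symm m)) =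
      Function.update (fun m => Fin.append u w (Fin.cast h.symm m))
        (Fin.cast h (Fin.natAdd k b)) x := by
  funext m
  obtain ⟨n, rfl⟩ : ∃ n, m = Fin.cast h n := ⟨Fin.cast h.symm m, by simp⟩
  refine Fin.addCases (fun a => ?_) (fun c => ?_) n
  · rw [Function.update_of_ne (by intro h'; simp [Fin.ext_iff] at h'; omega)]
    simp
  · by_cases hc : c = b
    · subst hc; simp
    · rw [Function.update_of_ne (by simpa [Fin.ext_iff] using hc)]
      simp [Function.update_of_ne hc]

theorem vol0_update_add (v : Fin 7 → E7) (i : Fin 7) (x y : E7) :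
    vol0 (Function.update v i (x + y)) =
      vol0 (Function.update v i x) + vol0 (Function.update v i y) := by
  have key : ∀ z : E7, (Matrix.of fun a j => Function.update v i z a j) =
      Matrix.updateRow (Matrix.of fun a j => v a j) i (fun j => z j) := by
    intro z
    ext a j
    by_cases ha : a = i
    · subst ha; simp
    · simp [Function.update_of_ne ha, Matrix.updateRow_ne ha]
  simp only [vol0, key]
  rw [← Matrix.det_updateRow_add]
  rfl

theorem vol0_update_smul (v : Fin 7 → E7) (i : Fin 7) (c : ℝ) (x : E7) :
    vol0 (Function.update v i (c • x)) = c * vol0 (Function.update v i x) := by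
  have key : ∀ z : E7, (Matrix.of fun a j => Function.update v i z a j) =
      Matrix.updateRow (Matrix.of fun a j => v a j) i (fun j => z j) := by
    intro z
    ext a j
    by_cases ha : a = i
    · subst ha; simp
    · simp [Function.update_of_ne ha, Matrix.updateRow_ne ha]
  simp only [vol0, key]
  rw [← Matrix.det_updateRow_smul]
  rfl

/-- The Hodge star `Λ^k → Λ^q`, `k + q = 7`, of the Euclidean metric and the standard orientation
of `ℝ⁷`: `(*α)(w) = 1/k! ∑_{i₁ … i_k} α(e_{i₁}, …, e_{i_k}) vol(e_{i₁}, …, e_{i_k}, w)`. -/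
def hodge0 {k q : ℕ} (h : k + q = 7) (α : E7 [⋀^Fin k]→L[ℝ] ℝ) : E7 [⋀^Fin q]→L[ℝ] ℝ where
  toFun w := (k ! : ℝ)⁻¹ * ∑ i : Fin k → Fin 7, α (fun a => basisVec (i a)) *
    vol0 (fun m => Fin.append (fun a => basisVec (i a)) w (Fin.cast h.symm m))
  map_update_add' := by
    intro _ w b x y
    simp only [append_update h, vol0_update_add, mul_add, Finset.sum_add_distrib]
  map_update_smul' := by
    intro _ w b c x
    simp only [append_update h, vol0_update_smul, smul_eq_mul, Finset.mul_sum]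
    exact Finset.sum_congr rfl fun i _ => by ring
  cont := by
    refine continuous_const.mul (continuous_finsetSum _ fun i _ => continuous_const.mul ?_)
    refine Continuous.matrix_det (continuous_matrix fun m j => ?_)
    obtain ⟨n, rfl⟩ : ∃ n, m = Fin.cast h n := ⟨Fin.cast h.symm m, by simp⟩
    refine Fin.addCases (fun a => ?_) (fun c => ?_) n
    · simp only [Matrix.of_apply, Fin.cast_cast, Fin.cast_eq_self, Fin.append_left]
      exact continuous_const
    · simp only [Matrix.of_apply, Fin.cast_cast, Fin.cast_eq_self, Fin.append_right]
      fun_prop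
  map_eq_zero_of_eq' := by
    intro w b c hbc hne
    rw [Finset.sum_eq_zero, mul_zero]
    intro i _
    rw [vol0, Matrix.det_zero_of_row_eq (i := Fin.cast h (Fin.natAdd k b))
      (j := Fin.cast h (Fin.natAdd k c)), mul_zero]
    · simpa [Fin.ext_iff] using hne
    · ext j
      simp [hbc]

/-- The contraction `a ⌟ β` of a form `β` with a one-form `a` on Euclidean `ℝ⁷`: the vector
metrically dual to `a` is inserted in the first slot of `β`. -/
def contract0 {k : ℕ} (a : E7 [⋀^Fin 1]→L[ℝ] ℝ) (β : E7 [⋀^Fin (k + 1)]→L[ℝ] ℝ) :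
    E7 [⋀^Fin k]→L[ℝ] ℝ :=
  β.curryLeft (∑ i : Fin 7, a (fun _ => basisVec i) • basisVec i)

/-! ### Differential forms on a seven-manifold -/

section Manifold

variable {Y : Type*} [TopologicalSpace Y] [ChartedSpace E7 Y]

/-- (Not necessarily smooth) differential `k`-forms on the seven-manifold `Y`. -/
abbrev Form (Y : Type*) [TopologicalSpace Y] [ChartedSpace E7 Y] (k : ℕ) : Type _ :=
  ∀ x : Y, TangentSpace (𝓡 7) x [⋀^Fin k]→L[ℝ] ℝ

/-- The expression of a form in the chart `e`, that is its pullback along `e.symm`. -/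
def inChart {k : ℕ} (e : OpenPartialHomeomorph Y E7) (α : Form Y k) (z : E7) :
    E7 [⋀^Fin k]→L[ℝ] ℝ :=
  (α (e.symm z)).compContinuousLinearMap (mfderiv (𝓡 7) (𝓡 7) e.symm z)

/-- A form is smooth if its expressions in all the charts of the atlas are smooth. -/
def IsSmooth {k : ℕ} (α : Form Y k) : Prop :=
  ∀ e ∈ atlas E7 Y, ContDiffOn ℝ ∞ (inChart e α) e.target

/-- The exterior derivative of a `k`-form, computed at `x` in the preferred chart around `x`. -/
def d {k : ℕ} (α : Form Y k) : Form Y (k + 1) := fun x =>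
  (extDeriv (inChart (chartAt E7 x) α) (chartAt E7 x x)).compContinuousLinearMap
    (mfderiv (𝓡 7) (𝓡 7) (chartAt E7 x) x)

/-- The differential of a function, as a one-form. -/
def dFun (f : Y → ℝ) : Form Y 1 := fun x =>
  ContinuousAlternatingMap.ofSubsingleton ℝ (TangentSpace (𝓡 7) x) ℝ 0 (mvfderiv (𝓡 7) f x)

/-- A function regarded as a zero-form. -/
def ofFun (f : Y → ℝ) : Form Y 0 := fun x =>
  ContinuousAlternatingMap.constOfIsEmpty ℝ (TangentSpace (𝓡 7) x) (Fin 0) (f x)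

/-- The product of a function and a form. -/
def fmul {k : ℕ} (f : Y → ℝ) (α : Form Y k) : Form Y k := fun x => f x • α x

/-- The wedge product of forms. -/
def fwedge {k l : ℕ} (α : Form Y k) (β : Form Y l) : Form Y (k + l) := fun x => wedge (α x) (β x)

/-- The lowest order Bianchi identities: `H` is closed and `f` is constant. -/
def Bianchi (H : Form Y 3) (f : Y → ℝ) : Prop := d H = 0 ∧ ∃ c : ℝ, ∀ y, f y = c

end Manifold

/-! ### `G₂` structures -/

/-- A `G₂` structure on `Y`: a smooth three-form that is positive, that is, identified with the
standard three-form `phi0` by some linear isomorphism `T_x Y ≃ ℝ⁷` at every point. -/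
structure G2Structure (Y : Type*) [TopologicalSpace Y] [ChartedSpace E7 Y] where
  /-- The three-form `φ`. -/
  form : Form Y 3
  smooth : IsSmooth form
  positive : ∀ x, ∃ u : TangentSpace (𝓡 7) x ≃L[ℝ] E7,
    form x = phi0.compContinuousLinearMap (u : TangentSpace (𝓡 7) x →L[ℝ] E7)

namespace G2Structure

variable {Y : Type*} [TopologicalSpace Y] [ChartedSpace E7 Y] (G : G2Structure Y)

/-- An adapted frame at `x`: an isomorphism `T_x Y ≃ ℝ⁷` that takes `φ` to `phi0`. The metric and
the orientation induced by `φ` are those that it pulls back from `ℝ⁷`; since two adapted frames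
differ by an element of the stabiliser `G₂ ⊆ SO(7)` of `phi0`, they (and the operators below) do
not depend on the frame. -/
def frame (x : Y) : TangentSpace (𝓡 7) x ≃L[ℝ] E7 := (G.positive x).choose

/-- The Hodge star on `k`-forms of the metric and orientation induced by `φ`. -/
def hodge {k q : ℕ} (h : k + q = 7) (α : Form Y k) : Form Y q := fun x =>
  (hodge0 h ((α x).compContinuousLinearMap
      ((G.frame x).symm : E7 →L[ℝ] TangentSpace (𝓡 7) x))).compContinuousLinearMap
    (G.frame x : TangentSpace (𝓡 7) x →L[ℝ] E7)

/-- The contraction `a ⌟ β` of a form with a one-form, in the metric induced by `φ`. -/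
def contract {k : ℕ} (a : Form Y 1) (β : Form Y (k + 1)) : Form Y k := fun x =>
  (contract0
      ((a x).compContinuousLinearMap ((G.frame x).symm : E7 →L[ℝ] TangentSpace (𝓡 7) x))
      ((β x).compContinuousLinearMap
        ((G.frame x).symm : E7 →L[ℝ] TangentSpace (𝓡 7) x))).compContinuousLinearMap
    (G.frame x : TangentSpace (𝓡 7) x →L[ℝ] E7)

/-- The four-form `ψ = *φ`. -/
def psi : Form Y 4 := G.hodge (k := 3) (q := 4) rfl G.form

/-- `τ₀, τ₁, τ₂, τ₃` are the torsion classes of the `G₂` structure: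
`dφ = τ₀ ψ + 3 τ₁ ∧ φ + *τ₃` and `dψ = 4 τ₁ ∧ ψ + *τ₂`, where `τ₂` lies in `Λ²₁₄`
(that is, `τ₂ ∧ ψ = 0`) and `τ₃` lies in `Λ³₂₇` (that is, `φ ∧ *τ₃ = 0` and `τ₃ ∧ φ = 0`).
These conditions determine the four forms. -/
structure IsTorsion (τ₀ : Y → ℝ) (τ₁ : Form Y 1) (τ₂ : Form Y 2) (τ₃ : Form Y 3) : Prop where
  d_form : (d G.form : Form Y 4) = fmul τ₀ G.psi + (3 : ℝ) • (fwedge τ₁ G.form : Form Y 4)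
    + G.hodge (k := 3) (q := 4) rfl τ₃
  d_psi : (d G.psi : Form Y 5) = (4 : ℝ) • (fwedge τ₁ G.psi : Form Y 5)
    + G.hodge (k := 2) (q := 5) rfl τ₂
  two_mem : fwedge τ₂ G.psi = 0
  form_wedge_star_three : fwedge G.form (G.hodge (k := 3) (q := 4) rfl τ₃) = 0
  three_wedge_form : fwedge τ₃ G.form = 0

/-- The Killing spinor equations for the `G₂` structure `φ`, the dilaton `ϕ`, the flux `H` along
`Y` and the flux component `f` along the three-dimensional space-time. -/
structure KillingSpinor (ϕ : Y → ℝ) (H : Form Y 3) (f : Y → ℝ) : Prop where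
  d_form : (d G.form : Form Y 4) = (2 : ℝ) • (fwedge (dFun ϕ) G.form : Form Y 4)
    - G.hodge (k := 3) (q := 4) rfl H - fmul f G.psi
  d_psi : (d G.psi : Form Y 5) = (2 : ℝ) • (fwedge (dFun ϕ) G.psi : Form Y 5)
  star_d_dilaton : G.hodge (k := 1) (q := 6) rfl (dFun ϕ)
    = -((1 / 2 : ℝ) • (fwedge H G.form : Form Y 6))
  star_f : (1 / 2 : ℝ) • G.hodge (k := 0) (q := 7) rfl (ofFun f) = (fwedge H G.psi : Form Y 7)

/-- `H = (1/14) f φ + Hp` with `Hp` orthogonal to `φ`. -/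
structure IsFluxDecomposition (H : Form Y 3) (f : Y → ℝ) (Hp : Form Y 3) : Prop where
  eq : H = fmul (fun y => 1 / 14 * f y) G.form + Hp
  wedge_psi : fwedge Hp G.psi = 0
  star_wedge_form : fwedge (G.hodge (k := 3) (q := 4) rfl Hp) G.form = 0

/-- The flux equation of motion `d (* e^{-2ϕ} H) = 0`. -/
def FluxEOM (ϕ : Y → ℝ) (H : Form Y 3) : Prop :=
  d (G.hodge (k := 3) (q := 4) rfl (fmul (fun y => Real.exp (-2 * ϕ y)) H)) = 0

end G2Structure

end HetG2

end

/-!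
Since `φ ∧ ψ = 7 * 1`, the equation `½ * f = H ∧ ψ` says exactly that `H = (1/14) f φ + Hp` with
`Hp ∧ ψ = 0`. Put `τ₃ = -Hp - ½ dϕ ⌟ ψ`. Then `*(a ⌟ ψ) = -a ∧ φ` turns the equation for `dφ` into
the torsion equation, and `(a ⌟ ψ) ∧ φ = 4 * a` turns `*dϕ = -½ H ∧ φ` into `τ₃ ∧ φ = 0`. In an
adapted frame these identities reduce to contractions of the coefficients of `φ` and `ψ`.

For the flux equation of motion, `dφ = 2 dϕ ∧ φ - *H - f ψ` says that
`e^{-2ϕ} *H = -d(e^{-2ϕ} φ) - f e^{-2ϕ} ψ`, while `dψ = 2 dϕ ∧ ψ` says that `e^{-2ϕ} ψ` is closed.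

The Leibniz rule for `e^{-2ϕ} ψ` needs `ψ` to be differentiable, although adapted frames are chosen
pointwise with no regularity. Bryant's bilinear form `(u, v) ↦ *((u ⌟ φ) ∧ (v ⌟ φ) ∧ φ)`, which is
`6 (det A) ⟪A u, A v⟫` if `φ = A^* φ₀`, recovers the metric and the orientation, and therefore `ψ`,
as smooth functions of `φ`.
-/

open scoped Topology

namespace HetG2

/-! ### The wedge product -/

/-- The permutation `i ↦ i + l` of `Fin (k + l)`, which exchanges the first `k` places with the
last `l`. -/
def blockSwap (k l : ℕ) : Equiv.Perm (Fin (k + l)) :=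
  finAddFlip.trans (finCongr (Nat.add_comm l k))

@[simp]
theorem blockSwap_castAdd {k l : ℕ} (i : Fin k) :
    blockSwap k l (Fin.castAdd l i) = Fin.cast (Nat.add_comm l k) (Fin.natAdd l i) := by
  simp [blockSwap]

@[simp]
theorem blockSwap_natAdd {k l : ℕ} (j : Fin l) :
    blockSwap k l (Fin.natAdd k j) = Fin.cast (Nat.add_comm l k) (Fin.castAdd k j) := by
  simp [blockSwap]

theorem val_finRotate_pow {n : ℕ} (m : ℕ) (i : Fin (n + 1)) :
    ((finRotate (n + 1) ^ m) i : ℕ) = (i + m) % (n + 1) := by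
  induction m with
  | zero => simp [Nat.mod_eq_of_lt i.isLt]
  | succ m ih =>
    rw [pow_succ', Equiv.Perm.mul_apply, finRotate_apply, Fin.val_add, ih]
    simp [add_assoc]

theorem blockSwap_eq_finRotate_pow (k l : ℕ) : blockSwap k l = finRotate (k + l) ^ l := by
  ext i
  obtain ⟨n, hn⟩ : ∃ n, k + l = n + 1 := ⟨k + l - 1, by have := i.isLt; omega⟩
  have hrot : ((finRotate (k + l) ^ l) i : ℕ) = (i + l) % (k + l) := by
    revert i
    rw [hn]
    exact val_finRotate_pow l
  rw [hrot]
  induction i using Fin.addCases with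
  | left i =>
    have hi : l + (i : ℕ) < k + l := by omega
    simp [Nat.add_comm (i : ℕ), Nat.mod_eq_of_lt hi]
  | right j =>
    have hj : k + (j : ℕ) + l = j + (k + l) := by omega
    simp [hj, Nat.mod_eq_of_lt (show (j : ℕ) < k + l by omega)]

theorem sign_blockSwap (k l : ℕ) : Equiv.Perm.sign (blockSwap k l) = (-1) ^ (k * l) := by
  rw [blockSwap_eq_finRotate_pow, map_pow, sign_finRotate, ← pow_mul]
  rcases l with _ | l
  · simp
  · obtain ⟨c, hc⟩ := Nat.even_mul_succ_self l
    have : (k + (l + 1) - 1) * (l + 1) = k * (l + 1) + 2 * c := by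
      rw [← add_assoc, Nat.add_sub_cancel, add_mul, hc, two_mul]
    rw [this, pow_add, pow_mul _ 2 c]
    simp

section Wedge

variable {V : Type*} [AddCommGroup V] [Module ℝ V] [TopologicalSpace V]
  {W : Type*} [AddCommGroup W] [Module ℝ W] [TopologicalSpace W]

theorem comp_perm_apply {k : ℕ} (α : V [⋀^Fin k]→L[ℝ] ℝ) (v : Fin k → V)
    (σ : Equiv.Perm (Fin k)) : α (v ∘ σ) = Equiv.Perm.sign σ * α v := by
  simpa only [ContinuousAlternatingMap.coe_toAlternatingMap, Units.smul_def, zsmul_eq_mul] using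
    α.toAlternatingMap.map_perm v σ

theorem wedge_apply {k l : ℕ} (α : V [⋀^Fin k]→L[ℝ] ℝ) (β : V [⋀^Fin l]→L[ℝ] ℝ)
    (v : Fin (k + l) → V) :
    wedge α β v = ((k ! : ℝ) * (l ! : ℝ))⁻¹ * ∑ σ : Equiv.Perm (Fin (k + l)),
      (Equiv.Perm.sign σ : ℝ) * (α (fun i => v (σ (Fin.castAdd l i))) *
        β (fun j => v (σ (Fin.natAdd k j)))) := by
  simp only [wedge, ContinuousAlternatingMap.smul_apply, smul_eq_mul,
    ContinuousMultilinearMap.alternatization_apply_apply, Units.smul_def, zsmul_eq_mul]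
  rfl

theorem wedge_add_left {k l : ℕ} (α α' : V [⋀^Fin k]→L[ℝ] ℝ) (β : V [⋀^Fin l]→L[ℝ] ℝ) :
    wedge (α + α') β = wedge α β + wedge α' β := by
  ext v
  simp only [wedge_apply, ContinuousAlternatingMap.add_apply, add_mul, mul_add,
    Finset.sum_add_distrib]

theorem wedge_add_right {k l : ℕ} (α : V [⋀^Fin k]→L[ℝ] ℝ) (β β' : V [⋀^Fin l]→L[ℝ] ℝ) :
    wedge α (β + β') = wedge α β + wedge α β' := by
  ext v
  simp only [wedge_apply, ContinuousAlternatingMap.add_apply, mul_add,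
    Finset.sum_add_distrib]

theorem wedge_smul_left {k l : ℕ} (c : ℝ) (α : V [⋀^Fin k]→L[ℝ] ℝ) (β : V [⋀^Fin l]→L[ℝ] ℝ) :
    wedge (c • α) β = c • wedge α β := by
  ext v
  simp only [wedge_apply, ContinuousAlternatingMap.smul_apply, smul_eq_mul, Finset.mul_sum]
  exact Finset.sum_congr rfl fun σ _ => by ring

theorem wedge_smul_right {k l : ℕ} (c : ℝ) (α : V [⋀^Fin k]→L[ℝ] ℝ) (β : V [⋀^Fin l]→L[ℝ] ℝ) :
    wedge α (c • β) = c • wedge α β := by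
  ext v
  simp only [wedge_apply, ContinuousAlternatingMap.smul_apply, smul_eq_mul, Finset.mul_sum]
  exact Finset.sum_congr rfl fun σ _ => by ring

theorem wedge_compContinuousLinearMap {k l : ℕ} (α : V [⋀^Fin k]→L[ℝ] ℝ)
    (β : V [⋀^Fin l]→L[ℝ] ℝ) (A : W →L[ℝ] V) :
    (wedge α β).compContinuousLinearMap A =
      wedge (α.compContinuousLinearMap A) (β.compContinuousLinearMap A) := by
  ext v
  simp only [wedge_apply, ContinuousAlternatingMap.compContinuousLinearMap_apply]
  rfl

theorem wedge_comm_apply {k l : ℕ} (α : V [⋀^Fin k]→L[ℝ] ℝ) (β : V [⋀^Fin l]→L[ℝ] ℝ)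
    (v : Fin (k + l) → V) (w : Fin (l + k) → V) (hvw : v ∘ Fin.cast (Nat.add_comm l k) = w) :
    wedge β α w = (-1) ^ (k * l) * wedge α β v := by
  subst hvw
  let c : Fin (l + k) ≃ Fin (k + l) := finCongr (Nat.add_comm l k)
  have hsign (σ : Equiv.Perm (Fin (l + k))) :
      Equiv.Perm.sign (Equiv.equivCongr finAddFlip.symm c σ) =
        (-1) ^ (k * l) * Equiv.Perm.sign σ := by
    have : Equiv.equivCongr finAddFlip.symm c σ = c.permCongr σ * blockSwap k l := by
      ext i
      simp [blockSwap, c]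
    rw [this, map_mul, Equiv.Perm.sign_permCongr, sign_blockSwap, mul_comm]
  rw [wedge_apply, wedge_apply, ← (Equiv.equivCongr finAddFlip.symm c).sum_comp]
  simp only [hsign, Equiv.equivCongr_apply_apply, Equiv.symm_symm, finAddFlip_apply_castAdd,
    finAddFlip_apply_natAdd, Finset.mul_sum, c]
  refine Finset.sum_congr rfl fun σ _ => ?_
  have hsq : ((-1 : ℝ) ^ (k * l)) * (-1) ^ (k * l) = 1 := by
    rw [← mul_pow]
    simp
  push_cast
  simp only [Function.comp_apply, finCongr_apply]
  linear_combination (-((l ! : ℝ) * k !)⁻¹ * Equiv.Perm.sign σ *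
    β (fun i => v (Fin.cast (Nat.add_comm l k) (σ (Fin.castAdd k i)))) *
    α (fun j => v (Fin.cast (Nat.add_comm l k) (σ (Fin.natAdd l j))))) * hsq

theorem wedge_comm_of_odd {k : ℕ} (hk : Odd k) (α β : V [⋀^Fin k]→L[ℝ] ℝ) :
    wedge β α = -wedge α β := by
  ext v
  rw [wedge_comm_apply α β v v rfl, (hk.mul hk).neg_one_pow, neg_one_mul]
  rfl

theorem wedge_self_of_odd {k : ℕ} (hk : Odd k) (α : V [⋀^Fin k]→L[ℝ] ℝ) : wedge α α = 0 := by
  ext v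
  exact self_eq_neg.1 (congrArg (· v) (wedge_comm_of_odd hk α α))

theorem sum_append {ι M : Type*} [Fintype ι] [AddCommMonoid M] {k l : ℕ}
    (F : (Fin (k + l) → ι) → M) :
    ∑ K, F K = ∑ I : Fin k → ι, ∑ J : Fin l → ι, F (Fin.append I J) := by
  rw [← (Fin.appendEquiv k l).sum_comp, Fintype.sum_prod_type]
  rfl

theorem sign_mul_sign {k : ℕ} (σ : Equiv.Perm (Fin k)) :
    ((Equiv.Perm.sign σ : ℤ) : ℝ) * ((Equiv.Perm.sign σ : ℤ) : ℝ) = 1 := by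
  rw [← Int.cast_mul, ← Units.val_mul, Int.units_mul_self]
  simp

theorem sign_decomposeFin_symm_mul_apply {k : ℕ} (β : V [⋀^Fin k]→L[ℝ] ℝ) (v : Fin (k + 1) → V)
    (p : Fin (k + 1)) (e : Equiv.Perm (Fin k)) :
    (Equiv.Perm.sign (Equiv.Perm.decomposeFin.symm (p, e)) : ℝ) *
        β (fun j => v (Equiv.Perm.decomposeFin.symm (p, e) j.succ)) =
      (-1) ^ (p : ℕ) * β (p.removeNth v) := by
  simp only [Equiv.Perm.decomposeFin_symm_apply_succ]
  have he := comp_perm_apply β (fun j => v (Equiv.swap 0 p j.succ)) e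
  simp only [Function.comp_def] at he
  rw [he, Equiv.Perm.decomposeFin.symm_sign]
  induction p using Fin.cases with
  | zero =>
    simp only [Equiv.swap_self, Equiv.refl_apply, if_true, Fin.val_zero, pow_zero, one_mul,
      Fin.removeNth_zero]
    exact (mul_assoc _ _ _).symm.trans (by rw [sign_mul_sign, one_mul]; rfl)
  | succ i =>
    have hi := comp_perm_apply β (i.succ.removeNth v) i.cycleRange
    simp only [Function.comp_def, Fin.removeNth_apply, Fin.succAbove_cycleRange,
      Fin.sign_cycleRange] at hi
    rw [hi, if_neg (Fin.succ_ne_zero i), Fin.val_succ, pow_succ]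
    push_cast
    linear_combination -(-1) ^ (i : ℕ) * β (i.succ.removeNth v) * sign_mul_sign e

theorem wedge_one_apply {k : ℕ} (a : V [⋀^Fin 1]→L[ℝ] ℝ) (β : V [⋀^Fin k]→L[ℝ] ℝ)
    (v : Fin (k + 1) → V) (w : Fin (1 + k) → V) (hvw : v ∘ Fin.cast (Nat.add_comm 1 k) = w) :
    wedge a β w = ∑ p : Fin (k + 1), (-1) ^ (p : ℕ) * (a (fun _ => v p) * β (p.removeNth v)) := by
  subst hvw
  let c : Fin (k + 1) ≃ Fin (1 + k) := finCongr (Nat.add_comm k 1)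
  have hleft (σ : Equiv.Perm (Fin (k + 1))) (i : Fin 1) :
      Fin.cast (Nat.add_comm 1 k) (c.permCongr σ (Fin.castAdd k i)) = σ 0 := by
    simp [c, Subsingleton.elim i 0, Fin.castAdd]
  have hright (σ : Equiv.Perm (Fin (k + 1))) (j : Fin k) :
      Fin.cast (Nat.add_comm 1 k) (c.permCongr σ (Fin.natAdd 1 j)) = σ j.succ := by
    simp [c]
  rw [wedge_apply, ← (Equiv.Perm.decomposeFin.symm.trans c.permCongr).sum_comp,
    Fintype.sum_prod_type, Finset.mul_sum]
  refine Finset.sum_congr rfl fun p _ => ?_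
  simp only [Equiv.trans_apply, Equiv.Perm.sign_permCongr, Function.comp_apply, hleft, hright,
    Equiv.Perm.decomposeFin_symm_apply_zero, mul_left_comm _ (a _),
    sign_decomposeFin_symm_mul_apply, Finset.sum_const, Finset.card_univ, Fintype.card_perm,
    Fintype.card_fin, nsmul_eq_mul, Nat.factorial_one, Nat.cast_one, one_mul]
  have hk : (k ! : ℝ) ≠ 0 := by positivity
  rw [inv_mul_cancel_left₀ hk, mul_left_comm]

theorem sum_wedge_mul {ι : Type*} [Fintype ι] {k l : ℕ} (α : V [⋀^Fin k]→L[ℝ] ℝ)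
    (β : V [⋀^Fin l]→L[ℝ] ℝ) (e : ι → V) {g : (Fin (k + l) → ι) → ℝ}
    (hg : ∀ (K : Fin (k + l) → ι) (σ : Equiv.Perm (Fin (k + l))),
      g (K ∘ σ) = Equiv.Perm.sign σ * g K) :
    ∑ K, wedge α β (e ∘ K) * g K = ((k + l)! : ℝ) * ((k ! : ℝ) * (l ! : ℝ))⁻¹ *
      ∑ I : Fin k → ι, ∑ J : Fin l → ι, α (e ∘ I) * β (e ∘ J) * g (Fin.append I J) := by
  have hterm (σ : Equiv.Perm (Fin (k + l))) :
      ∑ K : Fin (k + l) → ι, (Equiv.Perm.sign σ : ℝ) *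
        (α (fun i => e (K (σ (Fin.castAdd l i)))) * β (fun j => e (K (σ (Fin.natAdd k j))))) * g K =
      ∑ I : Fin k → ι, ∑ J : Fin l → ι, α (e ∘ I) * β (e ∘ J) * g (Fin.append I J) := by
    rw [← (Equiv.arrowCongr σ (Equiv.refl ι)).sum_comp, sum_append]
    refine Finset.sum_congr rfl fun I _ => Finset.sum_congr rfl fun J _ => ?_
    have hcongr : Equiv.arrowCongr σ (Equiv.refl ι) (Fin.append I J) = Fin.append I J ∘ σ.symm :=
      rfl
    simp only [hcongr, hg, Function.comp_apply, Equiv.symm_apply_apply, Fin.append_left,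
      Fin.append_right, Equiv.Perm.sign_symm, Function.comp_def e]
    linear_combination (α (fun i => e (I i)) * β (fun j => e (J j)) * g (Fin.append I J)) *
      sign_mul_sign σ
  simp only [wedge_apply, Function.comp_apply, mul_assoc _ _ (g _), Finset.sum_mul]
  simp only [← mul_assoc _ _ (g _)]
  rw [← Finset.mul_sum, Finset.sum_comm, Finset.sum_congr rfl fun σ _ => hterm σ,
    Finset.sum_const, Finset.card_univ, Fintype.card_perm, Fintype.card_fin, nsmul_eq_mul]
  ring

end Wedge

/-! ### Volumes of basis tuples -/

/-- The tuple `(e_{I 0}, …, e_{I (k - 1)})` of standard basis vectors. -/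
noncomputable def basisTuple {k : ℕ} (I : Fin k → Fin 7) : Fin k → E7 := basisVec ∘ I

/-- The standard volume of the seven vectors `u, w`: the kernel of the Hodge star. -/
noncomputable def volAppend {k q : ℕ} (h : k + q = 7) (u : Fin k → E7) (w : Fin q → E7) : ℝ :=
  vol0 fun m => Fin.append u w (Fin.cast h.symm m)

/-- The standard basis of `ℝ⁷`, as an algebraic basis. -/
noncomputable abbrev stdBasis : Module.Basis (Fin 7) ℝ E7 :=
  (EuclideanSpace.basisFun (Fin 7) ℝ).toBasis

theorem coe_stdBasis : ⇑stdBasis = basisVec := by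
  ext i : 1
  simp [stdBasis, basisVec]

theorem vol0_eq_det (v : Fin 7 → E7) : vol0 v = stdBasis.det v := by
  rw [Module.Basis.det_apply, vol0, ← Matrix.det_transpose]
  rfl

theorem basisTuple_append {k l : ℕ} (I : Fin k → Fin 7) (J : Fin l → Fin 7) :
    basisTuple (Fin.append I J) = Fin.append (basisTuple I) (basisTuple J) := by
  funext m
  refine Fin.addCases (fun a => ?_) (fun a => ?_) m <;> simp [basisTuple]

theorem vol0_comp_perm (v : Fin 7 → E7) (σ : Equiv.Perm (Fin 7)) :
    vol0 (v ∘ σ) = Equiv.Perm.sign σ * vol0 v := by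
  simp only [vol0_eq_det, AlternatingMap.map_perm, Units.smul_def, zsmul_eq_mul]

theorem vol0_basisTuple_sq {K : Fin 7 → Fin 7} (hK : Function.Injective K) :
    vol0 (basisTuple K) * vol0 (basisTuple K) = 1 := by
  have h := vol0_comp_perm basisVec (Equiv.ofBijective K (Finite.injective_iff_bijective.1 hK))
  rw [vol0_eq_det basisVec, ← coe_stdBasis, Module.Basis.det_self, mul_one] at h
  have hK : basisTuple K = stdBasis ∘ K := by rw [coe_stdBasis]; rfl
  rw [hK]
  exact h ▸ sign_mul_sign _

section VolAppend

variable {k l q : ℕ}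

theorem volAppend_comp_perm (h : k + q = 7) (u : Fin k → E7) (w : Fin q → E7)
    (σ : Equiv.Perm (Fin k)) :
    volAppend h (u ∘ σ) w = Equiv.Perm.sign σ * volAppend h u w := by
  have key : (fun m => Fin.append (u ∘ σ) w (Fin.cast h.symm m)) =
      (fun m => Fin.append u w (Fin.cast h.symm m)) ∘
        (finSumFinEquiv.trans (finCongr h)).permCongr (Equiv.Perm.sumCongr σ 1) := by
    funext m
    obtain ⟨n, rfl⟩ := (finSumFinEquiv.trans (finCongr h)).surjective m
    rcases n with a | a <;> simp
  rw [volAppend, key, vol0_comp_perm, Equiv.Perm.sign_permCongr, Equiv.Perm.sign_sumCongr]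
  simp [volAppend]

theorem volAppend_append (h : k + l + q = 7) (h' : k + (l + q) = 7) (u : Fin k → E7)
    (v : Fin l → E7) (w : Fin q → E7) :
    volAppend h (Fin.append u v) w = volAppend h' u (Fin.append v w) := by
  simp only [volAppend, Fin.append_assoc, Function.comp_apply, Fin.cast_cast]

theorem volAppend_comm (h : k + q = 7) (h' : q + k = 7) (u : Fin k → E7) (w : Fin q → E7) :
    volAppend h' w u = volAppend h u w := by
  have key : (fun m => Fin.append w u (Fin.cast h'.symm m)) =
      (fun m => Fin.append u w (Fin.cast h.symm m)) ∘ (finCongr h').permCongr (blockSwap q k) := by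
    funext m
    obtain ⟨n, rfl⟩ := (finCongr h').surjective m
    induction n using Fin.addCases <;> simp
  have hkq : Even (q * k) := by
    rw [Nat.even_mul]
    by_contra! hodd
    have := (Nat.not_even_iff_odd.1 hodd.1).add_odd (Nat.not_even_iff_odd.1 hodd.2)
    rw [h'] at this
    exact absurd this (by decide)
  rw [volAppend, key, vol0_comp_perm, Equiv.Perm.sign_permCongr, sign_blockSwap, hkq.neg_one_pow]
  simp [volAppend]

theorem volAppend_basisTuple (h : k + q = 7) (I : Fin k → Fin 7) (J : Fin q → Fin 7) :
    volAppend h (basisTuple I) (basisTuple J) =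
      vol0 (basisTuple (Fin.append I J ∘ Fin.cast h.symm)) := by
  rw [volAppend, ← basisTuple_append]
  rfl

theorem volAppend_basisTuple_sq (h : k + q = 7) {I : Fin k → Fin 7} {J : Fin q → Fin 7}
    (hIJ : Function.Injective (Fin.append I J)) :
    volAppend h (basisTuple I) (basisTuple J) * volAppend h (basisTuple I) (basisTuple J) = 1 := by
  rw [volAppend_basisTuple]
  exact vol0_basisTuple_sq (hIJ.comp (Fin.cast_injective _))

theorem injective_append_of_volAppend_ne_zero {h : k + q = 7} {I : Fin k → Fin 7}
    {J : Fin q → Fin 7} (hIJ : volAppend h (basisTuple I) (basisTuple J) ≠ 0) :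
    Function.Injective (Fin.append I J) := by
  rw [volAppend_basisTuple, vol0_eq_det] at hIJ
  intro a b hab
  by_contra hne
  refine hIJ (AlternatingMap.map_eq_zero_of_eq _ _ (i := Fin.cast h a) (j := Fin.cast h b) ?_ ?_)
  · simp [basisTuple, hab]
  · simpa using hne

end VolAppend

/-! ### Tuples that split the index set -/

section Tuples

variable {ι : Type*} [Fintype ι] {k q : ℕ}

theorem isCompl_range_of_injective_append (h : k + q = Fintype.card ι) {I : Fin k → ι}
    {J : Fin q → ι} (hIJ : Function.Injective (Fin.append I J)) :
    IsCompl (Set.range I) (Set.range J) := by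
  have hsurj : Function.Surjective (Fin.append I J) :=
    ((Fintype.bijective_iff_injective_and_card _).2 ⟨hIJ, by simp [h]⟩).2
  refine ⟨Set.disjoint_range_iff.2 (Fin.append_injective_iff.1 hIJ).2.2,
    codisjoint_iff.2 (Set.eq_univ_of_forall fun i => ?_)⟩
  obtain ⟨m, rfl⟩ := hsurj i
  induction m using Fin.addCases <;> simp

theorem exists_eq_comp_perm {α β : Type*} {I K : α → β} (hI : Function.Injective I)
    (hK : Function.Injective K) (h : Set.range I = Set.range K) :
    ∃ π : Equiv.Perm α, I = K ∘ π :=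
  ⟨(Equiv.ofInjective I hI).trans ((Equiv.setCongr h).trans (Equiv.ofInjective K hK).symm), by
    ext a
    simp [Equiv.apply_ofInjective_symm]⟩

theorem injective_append_comm {α : Type*} {I : Fin k → α} {J : Fin q → α}
    (hIJ : Function.Injective (Fin.append I J)) : Function.Injective (Fin.append J I) := by
  obtain ⟨hI, hJ, hne⟩ := Fin.append_injective_iff.1 hIJ
  exact Fin.append_injective_iff.2 ⟨hJ, hI, fun b a => (hne a b).symm⟩

theorem exists_injective_append [LinearOrder ι] (h : k + q = Fintype.card ι) {I : Fin k → ι}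
    (hI : Function.Injective I) :
    ∃ J : Fin q → ι, StrictMono J ∧ Function.Injective (Fin.append I J) := by
  have hc : ((Finset.univ.image I)ᶜ).card = q := by
    rw [Finset.card_compl, Finset.card_image_of_injective _ hI, Finset.card_univ, Fintype.card_fin]
    omega
  refine ⟨((Finset.univ.image I)ᶜ).orderEmbOfFin hc, (Finset.orderEmbOfFin _ hc).strictMono,
    Fin.append_injective_iff.2
    ⟨hI, (Finset.orderEmbOfFin _ hc).injective, fun a b hab => ?_⟩⟩
  have := Finset.orderEmbOfFin_mem _ hc b
  simp [← hab] at this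

theorem sum_eq_sum_perm {M : Type*} [AddCommMonoid M] {K : Fin k → ι}
    (hK : Function.Injective K) (g : (Fin k → ι) → M)
    (hg : ∀ I, g I ≠ 0 → ∃ π : Equiv.Perm (Fin k), I = K ∘ π) :
    ∑ I, g I = ∑ π : Equiv.Perm (Fin k), g (K ∘ π) := by
  symm
  refine Finset.sum_of_injOn (fun π : Equiv.Perm (Fin k) => K ∘ π) ?_ (by simp) ?_ (by simp)
  · intro π _ ρ _ hπρ
    ext b
    exact congrArg _ (hK (congrFun hπρ b))
  · intro I _ hI
    by_contra hne
    obtain ⟨π, rfl⟩ := hg I hne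
    exact hI ⟨π, by simp⟩

theorem sum_tuple_succ {M : Type*} [AddCommMonoid M] {n : ℕ} (F : (Fin (n + 1) → ι) → M) :
    ∑ I, F I = ∑ i, ∑ I : Fin n → ι, F (Fin.cons i I) := by
  rw [← (Fin.consEquiv fun _ => ι).sum_comp, Fintype.sum_prod_type]
  rfl

theorem sum_tuple_one {M : Type*} [AddCommMonoid M] (F : (Fin 1 → ι) → M) :
    ∑ I, F I = ∑ i, F fun _ => i :=
  (Equiv.funUnique (Fin 1) ι).symm.sum_comp F |>.symm

theorem sum_tuple_two {M : Type*} [AddCommMonoid M] (F : (Fin 2 → ι) → M) :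
    ∑ I, F I = ∑ i, ∑ j, F ![i, j] := by
  simp only [sum_tuple_succ, Fintype.sum_unique]
  rfl

theorem sum_tuple_three {M : Type*} [AddCommMonoid M] (F : (Fin 3 → ι) → M) :
    ∑ I, F I = ∑ i, ∑ j, ∑ k, F ![i, j, k] := by
  simp only [sum_tuple_succ, Fintype.sum_unique]
  rfl

end Tuples

/-! ### The Hodge star of `ℝ⁷` -/

section Hodge

variable {k l q : ℕ}

theorem ext_basisTuple {α β : E7 [⋀^Fin k]→L[ℝ] ℝ}
    (h : ∀ I : Fin k → Fin 7, Function.Injective I → α (basisTuple I) = β (basisTuple I)) :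
    α = β := by
  refine ContinuousAlternatingMap.toAlternatingMap_injective
    (Module.Basis.ext_alternating stdBasis fun I hI => ?_)
  rw [coe_stdBasis]
  exact h I hI

theorem hodge0_apply (h : k + q = 7) (α : E7 [⋀^Fin k]→L[ℝ] ℝ) (w : Fin q → E7) :
    hodge0 h α w = (k ! : ℝ)⁻¹ *
      ∑ I : Fin k → Fin 7, α (basisTuple I) * volAppend h (basisTuple I) w := rfl

theorem isLinearMap_hodge0 (h : k + q = 7) :
    IsLinearMap ℝ (hodge0 h : E7 [⋀^Fin k]→L[ℝ] ℝ → E7 [⋀^Fin q]→L[ℝ] ℝ) where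
  map_add α β := by
    ext w
    simp only [hodge0_apply, ContinuousAlternatingMap.add_apply, add_mul, mul_add,
      Finset.sum_add_distrib]
  map_smul c α := by
    ext w
    simp only [hodge0_apply, ContinuousAlternatingMap.smul_apply, smul_eq_mul, mul_assoc]
    rw [← Finset.mul_sum, mul_left_comm]

theorem hodge0_basisTuple (h : k + q = 7) (α : E7 [⋀^Fin k]→L[ℝ] ℝ) {K : Fin k → Fin 7}
    {J : Fin q → Fin 7} (hKJ : Function.Injective (Fin.append K J)) :
    hodge0 h α (basisTuple J) =
      α (basisTuple K) * volAppend h (basisTuple K) (basisTuple J) := by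
  have hsupp (I : Fin k → Fin 7)
      (hI : α (basisTuple I) * volAppend h (basisTuple I) (basisTuple J) ≠ 0) :
      ∃ π : Equiv.Perm (Fin k), I = K ∘ π := by
    have hIJ := injective_append_of_volAppend_ne_zero (right_ne_zero_of_mul hI)
    have hrange : Set.range I = Set.range K :=
      (isCompl_range_of_injective_append (by simpa using h) hIJ).symm.right_unique
        (isCompl_range_of_injective_append (by simpa using h) hKJ).symm
    exact exists_eq_comp_perm (Fin.append_injective_iff.1 hIJ).1
      (Fin.append_injective_iff.1 hKJ).1 hrange
  have hterm (π : Equiv.Perm (Fin k)) :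
      α (basisTuple (K ∘ π)) * volAppend h (basisTuple (K ∘ π)) (basisTuple J) =
        α (basisTuple K) * volAppend h (basisTuple K) (basisTuple J) := by
    have hπ : basisTuple (K ∘ π) = basisTuple K ∘ π := rfl
    rw [hπ, comp_perm_apply, volAppend_comp_perm]
    linear_combination (α (basisTuple K) * volAppend h (basisTuple K) (basisTuple J)) *
      sign_mul_sign π
  rw [hodge0_apply, sum_eq_sum_perm (Fin.append_injective_iff.1 hKJ).1 _ hsupp]
  simp only [hterm, Finset.sum_const, Finset.card_univ, Fintype.card_perm, Fintype.card_fin,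
    nsmul_eq_mul]
  exact inv_mul_cancel_left₀ (by positivity) _

theorem hodge0_hodge0 (h : k + q = 7) (h' : q + k = 7) (α : E7 [⋀^Fin k]→L[ℝ] ℝ) :
    hodge0 h' (hodge0 h α) = α := by
  refine ext_basisTuple fun K hK => ?_
  obtain ⟨J, -, hKJ⟩ := exists_injective_append (by simpa using h) hK
  rw [hodge0_basisTuple h' _ (injective_append_comm hKJ), hodge0_basisTuple h α hKJ,
    volAppend_comm h h', mul_assoc, volAppend_basisTuple_sq h hKJ, mul_one]

theorem hodge0_injective (h : k + q = 7) : Function.Injective (hodge0 (k := k) h) :=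
  Function.LeftInverse.injective (hodge0_hodge0 h (by omega))

theorem hodge0_wedge (h : k + l + q = 7) (h' : k + (l + q) = 7) (α : E7 [⋀^Fin k]→L[ℝ] ℝ)
    (β : E7 [⋀^Fin l]→L[ℝ] ℝ) (w : Fin q → E7) :
    hodge0 h (wedge α β) w = (l ! : ℝ)⁻¹ * ∑ J : Fin l → Fin 7,
      β (basisTuple J) * hodge0 h' α (Fin.append (basisTuple J) w) := by
  have hsum : ∑ K, wedge α β (basisTuple K) * volAppend h (basisTuple K) w = _ :=
    sum_wedge_mul α β basisVec (g := fun K => volAppend h (basisTuple K) w)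
      fun K σ => volAppend_comp_perm h (basisTuple K) w σ
  have hkl : ((k + l)! : ℝ) ≠ 0 := by positivity
  rw [hodge0_apply, hsum, mul_assoc, inv_mul_cancel_left₀ hkl]
  simp only [basisTuple_append, volAppend_append h h', hodge0_apply h', Finset.mul_sum]
  rw [Finset.sum_comm]
  refine Finset.sum_congr rfl fun J _ => Finset.sum_congr rfl fun I _ => ?_
  simp only [basisTuple]
  ring

/-- The inner product on `k`-forms induced by the Euclidean metric, for which the forms
`e^{i₁ … i_k}` with `i₁ < ⋯ < i_k` are orthonormal. -/
noncomputable def formInner (α β : E7 [⋀^Fin k]→L[ℝ] ℝ) : ℝ :=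
  (k ! : ℝ)⁻¹ * ∑ I : Fin k → Fin 7, α (basisTuple I) * β (basisTuple I)

theorem formInner_comm (α β : E7 [⋀^Fin k]→L[ℝ] ℝ) : formInner α β = formInner β α := by
  simp only [formInner, mul_comm]

theorem wedge_eq_formInner_smul (h : k + q = 7) (α : E7 [⋀^Fin k]→L[ℝ] ℝ)
    (β : E7 [⋀^Fin q]→L[ℝ] ℝ) :
    wedge α β = formInner (hodge0 h α) β • hodge0 (k := 0) (by omega)
      (ContinuousAlternatingMap.constOfIsEmpty ℝ E7 (Fin 0) 1) := by
  refine hodge0_injective (q := 0) h ?_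
  ext w
  rw [(isLinearMap_hodge0 _).map_smul, hodge0_hodge0, hodge0_wedge _ h, formInner_comm, formInner]
  simp only [Fin.append_right_nil _ w rfl, ContinuousAlternatingMap.smul_apply,
    ContinuousAlternatingMap.constOfIsEmpty_apply, smul_eq_mul, mul_one]
  rfl

theorem wedge_hodge0_comm (h : k + q = 7) (α β : E7 [⋀^Fin k]→L[ℝ] ℝ) :
    wedge α (hodge0 h β) = wedge β (hodge0 h α) := by
  rw [wedge_eq_formInner_smul h, wedge_eq_formInner_smul h, formInner_comm]

theorem formInner_wedge (α : E7 [⋀^Fin k]→L[ℝ] ℝ) (β : E7 [⋀^Fin l]→L[ℝ] ℝ)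
    (γ : E7 [⋀^Fin (k + l)]→L[ℝ] ℝ) :
    formInner (wedge α β) γ = (l ! : ℝ)⁻¹ * ∑ J, β (basisTuple J) *
      ((k ! : ℝ)⁻¹ * ∑ I, α (basisTuple I) * γ (Fin.append (basisTuple I) (basisTuple J))) := by
  have hsum : ∑ K, wedge α β (basisTuple K) * γ (basisTuple K) = _ :=
    sum_wedge_mul α β basisVec (g := fun K => γ (basisTuple K))
      fun K σ => comp_perm_apply γ (basisTuple K) σ
  have hkl : ((k + l)! : ℝ) ≠ 0 := by positivity
  rw [formInner, hsum, mul_assoc, inv_mul_cancel_left₀ hkl, Finset.sum_comm]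
  simp only [basisTuple_append, Finset.mul_sum]
  refine Finset.sum_congr rfl fun J _ => Finset.sum_congr rfl fun I _ => ?_
  simp only [basisTuple]
  ring

theorem hodge0_cast_apply {q' : ℕ} (h : k + q = 7) (h' : k + q' = 7)
    (α : E7 [⋀^Fin k]→L[ℝ] ℝ) (e : q = q') (w : Fin q' → E7) :
    hodge0 h α (w ∘ Fin.cast e) = hodge0 h' α w := by
  subst e
  rfl

theorem contract0_apply (a : E7 [⋀^Fin 1]→L[ℝ] ℝ) (β : E7 [⋀^Fin (k + 1)]→L[ℝ] ℝ)
    (w : Fin k → E7) :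
    contract0 a β w = ∑ i, a (fun _ => basisVec i) * β (Fin.cons (basisVec i) w) := by
  rw [contract0, map_sum, ContinuousAlternatingMap.sum_apply]
  refine Finset.sum_congr rfl fun i _ => ?_
  rw [map_smul]
  rfl

theorem contract0_hodge0 (h : k + (q + 1) = 7) (h' : k + 1 + q = 7) (a : E7 [⋀^Fin 1]→L[ℝ] ℝ)
    (α : E7 [⋀^Fin k]→L[ℝ] ℝ) :
    contract0 a (hodge0 h α) = hodge0 h' (wedge α a) := by
  ext w
  rw [contract0_apply, hodge0_wedge h' (by omega), sum_tuple_one, Nat.factorial_one, Nat.cast_one,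
    inv_one, one_mul]
  refine Finset.sum_congr rfl fun i _ => ?_
  rw [Fin.append_left_eq_cons, hodge0_cast_apply _ h]
  rfl

theorem formInner_wedge_hodge0_self (hk : Odd k) (h : k + (k + 1) = 7)
    (a : E7 [⋀^Fin 1]→L[ℝ] ℝ) (α : E7 [⋀^Fin k]→L[ℝ] ℝ) :
    formInner (wedge α a) (hodge0 h α) = 0 := by
  have hself (w : Fin 1 → E7) : (k ! : ℝ)⁻¹ * ∑ I : Fin k → Fin 7,
      α (basisTuple I) * hodge0 h α (Fin.append (basisTuple I) w) = 0 := by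
    rw [← hodge0_wedge (by omega) h, wedge_self_of_odd hk, (isLinearMap_hodge0 _).map_zero]
    rfl
  simp only [formInner_wedge, hself, mul_zero, Finset.sum_const_zero]

theorem wedge_wedge_self_of_odd (hk : Odd k) (h : k + (k + 1) = 7) (a : E7 [⋀^Fin 1]→L[ℝ] ℝ)
    (α : E7 [⋀^Fin k]→L[ℝ] ℝ) : wedge α (wedge α a) = 0 := by
  rw [wedge_eq_formInner_smul h, formInner_comm, formInner_wedge_hodge0_self hk h, zero_smul]

end Hodge

/-! ### Three-forms on `ℝ⁷` -/

section ThreeForms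

theorem wedge_three_one {V : Type*} [AddCommGroup V] [Module ℝ V] [TopologicalSpace V]
    (α : V [⋀^Fin 3]→L[ℝ] ℝ) (a : V [⋀^Fin 1]→L[ℝ] ℝ) :
    (wedge α a : V [⋀^Fin 4]→L[ℝ] ℝ) = -(wedge a α : V [⋀^Fin 4]→L[ℝ] ℝ) := by
  ext v
  refine (wedge_comm_apply (k := 1) (l := 3) a α v v rfl).trans ?_
  rw [Odd.neg_one_pow (by decide), neg_one_mul]
  rfl

theorem wedge_three_four {V : Type*} [AddCommGroup V] [Module ℝ V] [TopologicalSpace V]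
    (α : V [⋀^Fin 3]→L[ℝ] ℝ) (β : V [⋀^Fin 4]→L[ℝ] ℝ) :
    (wedge α β : V [⋀^Fin 7]→L[ℝ] ℝ) = (wedge β α : V [⋀^Fin 7]→L[ℝ] ℝ) := by
  ext v
  refine (wedge_comm_apply (k := 4) (l := 3) β α v v rfl).trans ?_
  rw [Even.neg_one_pow (by decide), one_mul]

theorem hodge0_contract0_hodge0 (a : E7 [⋀^Fin 1]→L[ℝ] ℝ) (α : E7 [⋀^Fin 3]→L[ℝ] ℝ) :
    hodge0 (k := 3) (q := 4) rfl (contract0 a (hodge0 (k := 3) (q := 3 + 1) rfl α)) =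
      -(wedge a α : E7 [⋀^Fin 4]→L[ℝ] ℝ) := by
  rw [contract0_hodge0 rfl rfl, ← wedge_three_one]
  exact hodge0_hodge0 (k := 3 + 1) (q := 3) rfl rfl (wedge α a)

theorem wedge_wedge_self_three (a : E7 [⋀^Fin 1]→L[ℝ] ℝ) (α : E7 [⋀^Fin 3]→L[ℝ] ℝ) :
    (wedge α (wedge a α : E7 [⋀^Fin 4]→L[ℝ] ℝ) : E7 [⋀^Fin 7]→L[ℝ] ℝ) = 0 := by
  rw [← neg_eq_iff_eq_neg.2 (wedge_three_one α a), ← neg_one_smul ℝ (wedge α a), wedge_smul_right]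
  exact smul_eq_zero_of_right _ (wedge_wedge_self_of_odd (k := 3) (by decide) rfl a α)

end ThreeForms

/-! ### Components of the standard `G₂` forms -/

/-- The multiplication table of the imaginary octonions: the entry `± (m + 1)` in row `a` and
column `b` says that `e_a × e_b = ± e_m`, and the entry `0` that `e_a × e_b = 0`. -/
def crossTable : List (List ℤ) :=
  [[ 0,  3, -2,  5, -4,  7, -6],
   [-3,  0,  1,  6, -7, -4,  5],
   [ 2, -1,  0, -7, -6,  5,  4],
   [-5, -6,  7,  0,  1,  2, -3],
   [ 4,  7,  6, -1,  0, -3, -2],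
   [-7,  4, -5, -2,  3,  0,  1],
   [ 6, -5, -4,  3,  2, -1,  0]]

/-- The signed label `± (m + 1)` of the vector product `e_a × e_b = ± e_m`. -/
def cross (a b : ℕ) : ℤ := (crossTable.getD a []).getD b 0

/-- The Kronecker delta, in a form that the kernel evaluates quickly. -/
def delta (a b : ℕ) : ℤ := bif a.beq b then 1 else 0

/-- The components `φ_{abc} = ⟨e_a × e_b, e_c⟩` of the standard three-form. -/
def phiCoeff (a b c : ℕ) : ℤ := bif (cross a b).natAbs.beq (c + 1) then (cross a b).sign else 0

/-- The components of the standard four-form, by the contraction identity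
`∑ m, φ_{abm} φ_{mcd} = δ_{ac} δ_{bd} - δ_{ad} δ_{bc} + ψ_{abcd}`: its left hand side has the
single term with `e_m = ± e_a × e_b`. -/
def psiCoeff (a b c d : ℕ) : ℤ :=
  delta a d * delta b c - delta a c * delta b d +
    (cross a b).sign * phiCoeff ((cross a b).natAbs - 1) c d

/-- The components `e^{ijk}(e_a, e_b, e_c)` of a monomial three-form. -/
def deltaThree (i j k a b c : Fin 7) : ℤ :=
  (delta a i * delta b j - delta a j * delta b i) * delta c k +
    (delta b i * delta c j - delta b j * delta c i) * delta a k +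
      (delta c i * delta a j - delta c j * delta a i) * delta b k

/-- The Vandermonde product `∏ (y - x)` over the pairs of entries `x` before `y` of a list. -/
def vandermondeProd {R : Type*} [CommRing R] : List R → R
  | [] => 1
  | x :: l => (l.map (· - x)).prod * vandermondeProd l

theorem deltaThree_sum : ∀ a b c : Fin 7,
    deltaThree 0 1 2 a b c + deltaThree 0 3 4 a b c + deltaThree 0 5 6 a b c +
      deltaThree 1 3 5 a b c - deltaThree 1 4 6 a b c - deltaThree 2 3 6 a b c -
      deltaThree 2 4 5 a b c = phiCoeff a b c := by
  decide +kernel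

theorem sum_phiCoeff_mul_phiCoeff : ∀ a b : Fin 7,
    ∑ i : Fin 7, ∑ j : Fin 7, phiCoeff a i j * phiCoeff b i j = 6 * delta a b := by
  decide +kernel

theorem sum_phiCoeff_mul_psiCoeff : ∀ a k l : Fin 7,
    ∑ i : Fin 7, ∑ j : Fin 7, phiCoeff a i j * psiCoeff i j k l = 4 * phiCoeff a k l := by
  decide +kernel

theorem sum_psiCoeff_mul_psiCoeff : ∀ a b : Fin 7,
    ∑ i : Fin 7, ∑ j : Fin 7, ∑ k : Fin 7, psiCoeff a i j k * psiCoeff i j k b =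
      -24 * delta a b := by
  decide +kernel

theorem psiCoeff_eq_zero_of_not_nodup : ∀ a b c d : Fin 7, ¬ [a, b, c, d].Nodup →
    psiCoeff a b c d = 0 := by
  decide +kernel

-- 24883200 = 1! 2! 3! 4! 5! 6! is the Vandermonde product of (0, …, 6), so its quotient with the
-- one on the left is the sign of the permutation (i, j, k, a, b, c, d).
theorem phiCoeff_mul_vandermondeProd : ∀ i j : Fin 7, i < j → ∀ k, j < k →
    ∀ a, a ∉ [i, j, k] → ∀ b, b ∉ [a, i, j, k] → ∀ c, c ∉ [b, a, i, j, k] →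
    ∀ d, d ∉ [c, b, a, i, j, k] →
    phiCoeff i j k * vandermondeProd ([i, j, k, a, b, c, d].map fun m => (m.val : ℤ)) =
      24883200 * psiCoeff a b c d := by
  decide +kernel

theorem map_vandermondeProd {R S : Type*} [CommRing R] [CommRing S] (f : R →+* S) (l : List R) :
    f (vandermondeProd l) = vandermondeProd (l.map f) := by
  induction l with
  | nil => exact map_one f
  | cons x l ih =>
    simp only [vandermondeProd, List.map_cons, List.map_map, map_mul, map_list_prod, ih,
      Function.comp_def, map_sub]

theorem vandermondeProd_ofFn {R : Type*} [CommRing R] {n : ℕ} (v : Fin n → R) :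
    vandermondeProd (List.ofFn v) = ∏ i, ∏ j ∈ Finset.Ioi i, (v j - v i) := by
  induction n with
  | zero => simp [vandermondeProd]
  | succ n ih =>
    rw [List.ofFn_succ, vandermondeProd, ih, Fin.prod_univ_succ, Fin.prod_Ioi_zero, List.map_ofFn,
      List.prod_ofFn]
    simp only [Fin.prod_Ioi_succ, Function.comp_apply]

theorem vol0_basisTuple_mul_superFactorial (K : Fin 7 → Fin 7) :
    vol0 (basisTuple K) * Nat.superFactorial 6 =
      vandermondeProd (List.ofFn fun i => ((K i).val : ℝ)) := by
  have hmul : Matrix.vandermonde (fun i => ((K i).val : ℝ)) =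
      (Matrix.of fun i j => basisTuple K i j) *
        Matrix.vandermonde (fun a : Fin (6 + 1) => (a.val : ℝ)) := by
    ext i j
    simp [Matrix.mul_apply, Matrix.vandermonde, basisTuple, basisVec]
  rw [vandermondeProd_ofFn, ← Matrix.det_vandermonde, hmul, Matrix.det_mul,
    Matrix.det_vandermonde_id_eq_superFactorial]
  rfl

/-- The standard four-form `ψ₀ = *φ₀`. -/
noncomputable def psi0 : E7 [⋀^Fin 4]→L[ℝ] ℝ := hodge0 rfl phi0

theorem dx_apply (i : Fin 7) (v : Fin 1 → E7) : dx i v = v 0 i := rfl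

theorem wedge_dx_dx_apply (i j : Fin 7) (v : Fin 2 → E7) :
    (wedge (dx i) (dx j) : E7 [⋀^Fin 2]→L[ℝ] ℝ) v = v 0 i * v 1 j - v 0 j * v 1 i := by
  refine (wedge_one_apply (dx i) (dx j) v v rfl).trans ?_
  simp [dx_apply, Fin.removeNth_apply, Fin.succAbove]
  ring

theorem dx3_apply (i j k : Fin 7) (v : Fin 3 → E7) :
    dx3 i j k v = (v 0 i * v 1 j - v 0 j * v 1 i) * v 2 k +
      (v 1 i * v 2 j - v 1 j * v 2 i) * v 0 k +
      (v 2 i * v 0 j - v 2 j * v 0 i) * v 1 k := by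
  refine (wedge_comm_apply (k := 1) (l := 2) (dx k)
    (wedge (dx i) (dx j) : E7 [⋀^Fin 2]→L[ℝ] ℝ) v v rfl).trans ?_
  rw [wedge_one_apply (dx k) _ v v rfl, Fin.sum_univ_three]
  simp only [dx_apply, wedge_dx_dx_apply, Fin.removeNth_apply]
  simp [Fin.succAbove]
  ring

theorem basisVec_apply (i j : Fin 7) : basisVec i j = (delta i j : ℝ) := by
  have hbeq : i.val.beq j.val = decide (j = i) := by
    rw [Bool.eq_iff_iff, Nat.beq_eq, decide_eq_true_iff, Fin.ext_iff, eq_comm]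
  simp [basisVec, delta, hbeq, cond_eq_ite]

theorem cast_delta (i j : Fin 7) : (delta i j : ℝ) = if i = j then 1 else 0 := by
  rw [← basisVec_apply]
  simp [basisVec, eq_comm]

theorem phi0_basisTuple (a b c : Fin 7) :
    phi0 (basisTuple ![a, b, c]) = (phiCoeff a b c : ℝ) := by
  rw [← deltaThree_sum]
  simp only [phi0, ContinuousAlternatingMap.add_apply, ContinuousAlternatingMap.sub_apply,
    dx3_apply, basisTuple, Function.comp_apply, Matrix.cons_val, basisVec_apply, deltaThree]
  push_cast
  ring

theorem psi0_basisTuple_of_injective {a b c d : Fin 7}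
    (hJ : Function.Injective ![a, b, c, d]) :
    psi0 (basisTuple ![a, b, c, d]) = (psiCoeff a b c d : ℝ) := by
  obtain ⟨K, hK, hJK⟩ := exists_injective_append (k := 4) (q := 3) rfl hJ
  have hKJ := injective_append_comm hJK
  have hK3 : K = ![K 0, K 1, K 2] := by ext m; fin_cases m <;> rfl
  have hlist : List.ofFn (Fin.append K ![a, b, c, d]) = [K 0, K 1, K 2, a, b, c, d] := rfl
  have hnodup : [K 0, K 1, K 2, a, b, c, d].Nodup := by rwa [← hlist, List.nodup_ofFn]
  have hstar : psi0 (basisTuple ![a, b, c, d]) = (phiCoeff (K 0) (K 1) (K 2) : ℝ) *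
      vol0 (basisTuple (Fin.append K ![a, b, c, d])) := by
    rw [psi0, hodge0_basisTuple (k := 3) (q := 4) rfl phi0 hKJ, volAppend_basisTuple,
      ← phi0_basisTuple, ← hK3]
    rfl
  have hvol : vol0 (basisTuple (Fin.append K ![a, b, c, d])) * 24883200 = vandermondeProd
      ([K 0, K 1, K 2, a, b, c, d].map fun m => (m.val : ℝ)) := by
    rw [← hlist, List.map_ofFn]
    simpa [Nat.superFactorial, Nat.factorial] using
      vol0_basisTuple_mul_superFactorial (Fin.append K ![a, b, c, d])
  have hcoeff := congrArg (Int.castRingHom ℝ) <| phiCoeff_mul_vandermondeProd (K 0) (K 1)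
    (hK (by decide)) (K 2) (hK (by decide)) a (by grind) b (by grind) c (by grind) d (by grind)
  rw [map_mul, map_vandermondeProd, List.map_map] at hcoeff
  simp only [Function.comp_def, map_natCast, map_mul, eq_intCast, Int.cast_ofNat] at hcoeff
  linear_combination hstar + (phiCoeff (K 0) (K 1) (K 2) / 24883200) * hvol + hcoeff / 24883200

theorem psi0_basisTuple (a b c d : Fin 7) :
    psi0 (basisTuple ![a, b, c, d]) = (psiCoeff a b c d : ℝ) := by
  by_cases hJ : Function.Injective ![a, b, c, d]
  · exact psi0_basisTuple_of_injective hJ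
  · have hofFn : List.ofFn ![a, b, c, d] = [a, b, c, d] := rfl
    rw [psiCoeff_eq_zero_of_not_nodup a b c d (by rwa [← hofFn, List.nodup_ofFn]), Int.cast_zero]
    exact psi0.map_eq_zero_of_not_injective _ fun h => hJ h.of_comp

/-! ### Identities of the standard `G₂` forms -/

theorem wedge_hodge0_eq_hodge0_wedge (α β : E7 [⋀^Fin 3]→L[ℝ] ℝ) :
    (wedge (hodge0 (k := 3) (q := 4) rfl α) β : E7 [⋀^Fin 7]→L[ℝ] ℝ) =
      (wedge α (hodge0 (k := 3) (q := 4) rfl β) : E7 [⋀^Fin 7]→L[ℝ] ℝ) := by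
  rw [← wedge_three_four]
  exact wedge_hodge0_comm (k := 3) (q := 4) rfl β α

theorem formInner_phi0_phi0 : formInner phi0 phi0 = 7 := by
  have hsum : ∑ a : Fin 7, ∑ i : Fin 7, ∑ j : Fin 7, phiCoeff a i j * phiCoeff a i j = 42 := by
    simp only [sum_phiCoeff_mul_phiCoeff]
    decide
  rw [formInner, sum_tuple_three]
  simp only [phi0_basisTuple]
  have hcast := congrArg (Int.cast (R := ℝ)) hsum
  push_cast at hcast
  rw [hcast]
  norm_num [Nat.factorial]

theorem wedge_phi0_psi0 : (wedge phi0 psi0 : E7 [⋀^Fin 7]→L[ℝ] ℝ) =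
    (7 : ℝ) • hodge0 (k := 0) (q := 7) rfl
      (ContinuousAlternatingMap.constOfIsEmpty ℝ E7 (Fin 0) 1) := by
  have hstar : hodge0 (k := 4) (q := 3) rfl psi0 = phi0 :=
    hodge0_hodge0 (k := 3) (q := 4) rfl rfl phi0
  have hwedge := wedge_eq_formInner_smul (k := 4) (q := 3) rfl psi0 phi0
  rw [hstar, formInner_phi0_phi0] at hwedge
  rw [wedge_three_four]
  exact hwedge

theorem sum_basisTuple_psi0_mul_psi0 (i j : Fin 7) :
    ∑ J : Fin 3 → Fin 7, psi0 (Fin.cons (basisVec i) (basisTuple J)) *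
      psi0 (Fin.append (basisTuple J) fun _ : Fin 1 => basisVec j) = -24 * (delta i j : ℝ) := by
  have hcons (a b c : Fin 7) : (Fin.cons (basisVec i) (basisTuple ![a, b, c]) : Fin 4 → E7) =
      basisTuple ![i, a, b, c] := by
    ext m : 1
    fin_cases m <;> rfl
  have happend (a b c : Fin 7) :
      (Fin.append (basisTuple ![a, b, c]) fun _ : Fin 1 => basisVec j : Fin 4 → E7) =
        basisTuple ![a, b, c, j] := by
    ext m : 1
    fin_cases m <;> rfl
  rw [sum_tuple_three]
  simp only [hcons, happend, psi0_basisTuple]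
  exact_mod_cast sum_psiCoeff_mul_psiCoeff i j

theorem hodge0_wedge_phi0_contract0_psi0 (a : E7 [⋀^Fin 1]→L[ℝ] ℝ) :
    hodge0 (k := 3 + 3) (q := 1) rfl (wedge phi0 (contract0 (k := 3) a psi0)) = (-4 : ℝ) • a := by
  refine ext_basisTuple fun K _ => ?_
  obtain ⟨j, rfl⟩ : ∃ j, K = fun _ => j := ⟨K 0, funext fun m => by rw [Subsingleton.elim m 0]⟩
  calc hodge0 (k := 3 + 3) (q := 1) rfl (wedge phi0 (contract0 (k := 3) a psi0))
        (basisTuple fun _ => j)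
    _ = (3 ! : ℝ)⁻¹ * ∑ J : Fin 3 → Fin 7,
          (∑ i, a (fun _ => basisVec i) * psi0 (Fin.cons (basisVec i) (basisTuple J))) *
            psi0 (Fin.append (basisTuple J) fun _ : Fin 1 => basisVec j) := by
      rw [hodge0_wedge (k := 3) (l := 3) (q := 1) rfl rfl]
      simp only [contract0_apply]
      rfl
    _ = (3 ! : ℝ)⁻¹ * ∑ i, a (fun _ => basisVec i) * (-24 * delta i j : ℝ) := by
      simp only [Finset.sum_mul, mul_assoc]
      rw [Finset.sum_comm]
      simp only [← Finset.mul_sum, sum_basisTuple_psi0_mul_psi0]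
    _ = -4 * a (fun _ => basisVec j) := by
      simp only [cast_delta, mul_ite, mul_one, mul_zero, Finset.sum_ite_eq', Finset.mem_univ,
        if_true]
      rw [show (3 ! : ℝ) = 6 by norm_num [Nat.factorial]]
      ring

theorem wedge_contract0_psi0_phi0 (a : E7 [⋀^Fin 1]→L[ℝ] ℝ) :
    (wedge (contract0 (k := 3) a psi0) phi0 : E7 [⋀^Fin 6]→L[ℝ] ℝ) =
      (4 : ℝ) • hodge0 (k := 1) (q := 6) rfl a := by
  refine hodge0_injective (k := 6) (q := 1) rfl ?_
  rw [(isLinearMap_hodge0 _).map_smul, hodge0_hodge0]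
  refine (congrArg (hodge0 (k := 3 + 3) (q := 1) rfl)
    (wedge_comm_of_odd (by decide) phi0 _)).trans ?_
  rw [(isLinearMap_hodge0 _).map_neg, hodge0_wedge_phi0_contract0_psi0]
  module

/-! ### Forms on a manifold with a `G₂` structure -/

section Form

variable {Y : Type*} [TopologicalSpace Y] [ChartedSpace E7 Y] {k l : ℕ}

theorem fwedge_add_left (α α' : Form Y k) (β : Form Y l) :
    fwedge (α + α') β = fwedge α β + fwedge α' β :=
  funext fun x => wedge_add_left (α x) (α' x) (β x)

theorem fwedge_add_right (α : Form Y k) (β β' : Form Y l) :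
    fwedge α (β + β') = fwedge α β + fwedge α β' :=
  funext fun x => wedge_add_right (α x) (β x) (β' x)

theorem fwedge_fmul_left (f : Y → ℝ) (α : Form Y k) (β : Form Y l) :
    fwedge (fmul f α) β = fmul f (fwedge α β) :=
  funext fun x => wedge_smul_left (f x) (α x) (β x)

theorem fwedge_smul_left (c : ℝ) (α : Form Y k) (β : Form Y l) :
    fwedge (c • α) β = c • fwedge α β :=
  fwedge_fmul_left (fun _ => c) α β

theorem fwedge_smul_right (c : ℝ) (α : Form Y k) (β : Form Y l) :
    fwedge α (c • β) = c • fwedge α β :=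
  funext fun x => wedge_smul_right c (α x) (β x)

theorem fwedge_zero_left (β : Form Y l) : fwedge (0 : Form Y k) β = 0 := by
  simpa only [zero_smul] using fwedge_smul_left (0 : ℝ) (0 : Form Y k) β

theorem fmul_const_mul (c : ℝ) (f : Y → ℝ) (α : Form Y k) :
    fmul (fun y => c * f y) α = c • fmul f α :=
  funext fun x => mul_smul c (f x) (α x)

end Form

namespace G2Structure

variable {Y : Type*} [TopologicalSpace Y] [ChartedSpace E7 Y] (G : G2Structure Y) {k l q : ℕ}

/-- The expression of a form at `x` in the adapted frame. -/
noncomputable def inFrame (α : Form Y k) (x : Y) : E7 [⋀^Fin k]→L[ℝ] ℝ :=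
  (α x).compContinuousLinearMap ((G.frame x).symm : E7 →L[ℝ] TangentSpace (𝓡 7) x)

theorem ext_inFrame {α β : Form Y k} (h : ∀ x, G.inFrame α x = G.inFrame β x) : α = β := by
  ext x v
  simpa [inFrame, Function.comp_def] using congrArg (fun θ => θ fun i => G.frame x (v i)) (h x)

theorem form_apply (x : Y) : G.form x =
    phi0.compContinuousLinearMap (G.frame x : TangentSpace (𝓡 7) x →L[ℝ] E7) :=
  (G.positive x).choose_spec

theorem compContinuousLinearMap_frame_frame_symm (x : Y) (θ : E7 [⋀^Fin k]→L[ℝ] ℝ) :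
    (θ.compContinuousLinearMap
      (G.frame x : TangentSpace (𝓡 7) x →L[ℝ] E7)).compContinuousLinearMap
        ((G.frame x).symm : E7 →L[ℝ] TangentSpace (𝓡 7) x) = θ := by
  ext v
  simp [Function.comp_def]

theorem inFrame_form (x : Y) : G.inFrame G.form x = phi0 := by
  rw [inFrame, form_apply, compContinuousLinearMap_frame_frame_symm]

theorem inFrame_hodge (h : k + q = 7) (α : Form Y k) (x : Y) :
    G.inFrame (G.hodge h α) x = hodge0 h (G.inFrame α x) :=
  G.compContinuousLinearMap_frame_frame_symm x _

theorem inFrame_contract (a : Form Y 1) (β : Form Y (k + 1)) (x : Y) :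
    G.inFrame (G.contract a β) x = contract0 (G.inFrame a x) (G.inFrame β x) :=
  G.compContinuousLinearMap_frame_frame_symm x _

theorem inFrame_psi (x : Y) : G.inFrame G.psi x = psi0 := by
  rw [psi, inFrame_hodge, inFrame_form, psi0]

theorem psi_apply (x : Y) : G.psi x =
    psi0.compContinuousLinearMap (G.frame x : TangentSpace (𝓡 7) x →L[ℝ] E7) := by
  rw [← G.inFrame_psi x]
  ext v
  simp [inFrame, Function.comp_def]

theorem inFrame_fwedge (α : Form Y k) (β : Form Y l) (x : Y) :
    G.inFrame (fwedge α β) x = wedge (G.inFrame α x) (G.inFrame β x) :=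
  wedge_compContinuousLinearMap _ _ _

theorem hodge_add (h : k + q = 7) (α β : Form Y k) :
    G.hodge h (α + β) = G.hodge h α + G.hodge h β :=
  funext fun x => congrArg (fun θ => ContinuousAlternatingMap.compContinuousLinearMap θ _) <|
    (isLinearMap_hodge0 h).map_add (G.inFrame α x) (G.inFrame β x)

theorem hodge_fmul (h : k + q = 7) (f : Y → ℝ) (α : Form Y k) :
    G.hodge h (fmul f α) = fmul f (G.hodge h α) :=
  funext fun x => congrArg (fun θ => ContinuousAlternatingMap.compContinuousLinearMap θ _) <|
    (isLinearMap_hodge0 h).map_smul (f x) (G.inFrame α x)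

theorem hodge_smul (h : k + q = 7) (c : ℝ) (α : Form Y k) :
    G.hodge h (c • α) = c • G.hodge h α :=
  G.hodge_fmul h (fun _ => c) α

theorem hodge_zero (h : k + q = 7) : G.hodge h (0 : Form Y k) = 0 := by
  simpa only [zero_smul] using G.hodge_smul h (0 : ℝ) 0

theorem hodge_fwedge_form (α : Form Y 3) :
    (fwedge (G.hodge (k := 3) (q := 4) rfl α) G.form : Form Y 7) =
      (fwedge α G.psi : Form Y 7) := by
  refine G.ext_inFrame fun x => ?_
  refine (G.inFrame_fwedge _ G.form x).trans (Eq.trans ?_ (G.inFrame_fwedge α G.psi x).symm)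
  rw [inFrame_hodge, inFrame_form, inFrame_psi]
  exact wedge_hodge0_eq_hodge0_wedge _ _

theorem form_fwedge_hodge (α : Form Y 3) :
    (fwedge G.form (G.hodge (k := 3) (q := 4) rfl α) : Form Y 7) =
      (fwedge α G.psi : Form Y 7) := by
  refine G.ext_inFrame fun x => ?_
  refine (G.inFrame_fwedge G.form _ x).trans (Eq.trans ?_ (G.inFrame_fwedge α G.psi x).symm)
  rw [inFrame_hodge, inFrame_form, inFrame_psi]
  exact wedge_hodge0_comm (k := 3) (q := 4) rfl _ _

theorem form_fwedge_psi : (fwedge G.form G.psi : Form Y 7) =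
    (7 : ℝ) • G.hodge (k := 0) (q := 7) rfl (ofFun fun _ => 1) := by
  refine G.ext_inFrame fun x => ?_
  refine (G.inFrame_fwedge G.form G.psi x).trans ?_
  rw [inFrame_form, inFrame_psi, ← hodge_smul, inFrame_hodge]
  refine wedge_phi0_psi0.trans ?_
  rw [← (isLinearMap_hodge0 _).map_smul]
  rfl

theorem hodge_ofFun (f : Y → ℝ) : G.hodge (k := 0) (q := 7) rfl (ofFun f) =
    fmul f (G.hodge (k := 0) (q := 7) rfl (ofFun fun _ => 1)) := by
  rw [← hodge_fmul]
  congr 1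
  ext x v
  simp [ofFun, fmul]

theorem hodge_contract_psi (a : Form Y 1) :
    G.hodge (k := 3) (q := 4) rfl (G.contract a (k := 3) G.psi) =
      (-1 : ℝ) • (fwedge a G.form : Form Y 4) := by
  rw [← fwedge_smul_left]
  refine G.ext_inFrame fun x => ?_
  refine Eq.trans ?_ (G.inFrame_fwedge ((-1 : ℝ) • a) G.form x).symm
  rw [inFrame_hodge, inFrame_form, inFrame_contract, inFrame_psi]
  refine (hodge0_contract0_hodge0 (G.inFrame a x) phi0).trans ?_
  rw [← neg_one_smul ℝ (wedge _ _), ← wedge_smul_left]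
  rfl

theorem contract_psi_fwedge_form (a : Form Y 1) :
    (fwedge (G.contract a (k := 3) G.psi) G.form : Form Y 6) =
      (4 : ℝ) • G.hodge (k := 1) (q := 6) rfl a := by
  refine G.ext_inFrame fun x => ?_
  refine (G.inFrame_fwedge (G.contract a (k := 3) G.psi) G.form x).trans ?_
  rw [inFrame_form, inFrame_contract, inFrame_psi, ← hodge_smul, inFrame_hodge]
  refine (wedge_contract0_psi0_phi0 (G.inFrame a x)).trans ?_
  rw [← (isLinearMap_hodge0 _).map_smul]
  rfl

theorem form_fwedge_form : (fwedge G.form G.form : Form Y 6) = 0 :=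
  funext fun x => wedge_self_of_odd (by decide) (G.form x)

theorem form_fwedge_fwedge_form (a : Form Y 1) :
    (fwedge G.form (fwedge a G.form : Form Y 4) : Form Y 7) = 0 := by
  refine G.ext_inFrame fun x => ?_
  refine (G.inFrame_fwedge G.form (fwedge a G.form : Form Y 4) x).trans ?_
  refine (congrArg _ (G.inFrame_fwedge a G.form x)).trans ?_
  rw [inFrame_form]
  exact wedge_wedge_self_three _ _

end G2Structure

/-! ### The Killing spinor equations in terms of torsion classes -/

namespace G2Structure

variable {Y : Type*} [TopologicalSpace Y] [ChartedSpace E7 Y] (G : G2Structure Y)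

theorem neg_sub_half_contract_psi (a : Form Y 1) (Hp : Form Y 3) :
    -Hp - (1 / 2 : ℝ) • G.contract a G.psi =
      (-1 : ℝ) • Hp + (-(1 / 2) : ℝ) • G.contract a (k := 3) G.psi := by
  module

theorem hodge_neg_sub_half_contract_psi (a : Form Y 1) (Hp : Form Y 3) :
    G.hodge (k := 3) (q := 4) rfl (-Hp - (1 / 2 : ℝ) • G.contract a G.psi) =
      -G.hodge (k := 3) (q := 4) rfl Hp + (1 / 2 : ℝ) • (fwedge a G.form : Form Y 4) := by
  rw [neg_sub_half_contract_psi, hodge_add, hodge_smul, hodge_smul, hodge_contract_psi]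
  module

theorem neg_sub_half_contract_psi_fwedge_form (a : Form Y 1) (Hp : Form Y 3) :
    (fwedge (-Hp - (1 / 2 : ℝ) • G.contract a G.psi) G.form : Form Y 6) =
      -(fwedge Hp G.form : Form Y 6) - (2 : ℝ) • G.hodge (k := 1) (q := 6) rfl a := by
  rw [neg_sub_half_contract_psi, fwedge_add_left, fwedge_smul_left, fwedge_smul_left,
    contract_psi_fwedge_form]
  module

theorem form_fwedge_hodge_neg_sub_half_contract_psi (a : Form Y 1) {Hp : Form Y 3}
    (hHp : (fwedge Hp G.psi : Form Y 7) = 0) :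
    (fwedge G.form (G.hodge (k := 3) (q := 4) rfl
      (-Hp - (1 / 2 : ℝ) • G.contract a G.psi)) : Form Y 7) = 0 := by
  have hstar := (G.form_fwedge_hodge Hp).trans hHp
  have ha := G.form_fwedge_fwedge_form a
  rw [neg_sub_half_contract_psi, hodge_add, hodge_smul, hodge_smul, hodge_contract_psi,
    fwedge_add_right, fwedge_smul_right, fwedge_smul_right, fwedge_smul_right, hstar, ha]
  module

variable {G} {ϕ f : Y → ℝ} {H Hp : Form Y 3}

theorem fwedge_form_of_eq_fmul_form_add (hH : H = fmul (fun y => 1 / 14 * f y) G.form + Hp) :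
    (fwedge H G.form : Form Y 6) = fwedge Hp G.form := by
  have h : (fwedge (fmul (fun y => 1 / 14 * f y) G.form) G.form : Form Y 6) = 0 := by
    refine (fwedge_fmul_left _ G.form G.form).trans ?_
    exact funext fun x => smul_eq_zero_of_right _ (congrFun G.form_fwedge_form x)
  rw [hH, fwedge_add_left, h, zero_add]

theorem fwedge_psi_of_eq_fmul_form_add (hH : H = fmul (fun y => 1 / 14 * f y) G.form + Hp) :
    (fwedge H G.psi : Form Y 7) = (1 / 2 : ℝ) • G.hodge (k := 0) (q := 7) rfl (ofFun f) +
      (fwedge Hp G.psi : Form Y 7) := by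
  have h : (fwedge (fmul (fun y => 1 / 14 * f y) G.form) G.psi : Form Y 7) =
      (1 / 2 : ℝ) • G.hodge (k := 0) (q := 7) rfl (ofFun f) := by
    refine (fwedge_fmul_left _ G.form G.psi).trans ?_
    rw [hodge_ofFun, fmul_const_mul]
    refine (congrArg (fun X => (1 / 14 : ℝ) • fmul f X) G.form_fwedge_psi).trans ?_
    ext x v
    simp [fmul]
    ring
  rw [hH, fwedge_add_left, h]

theorem hodge_of_eq_fmul_form_add (hH : H = fmul (fun y => 1 / 14 * f y) G.form + Hp) :
    G.hodge (k := 3) (q := 4) rfl H = (1 / 14 : ℝ) • fmul f G.psi +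
      G.hodge (k := 3) (q := 4) rfl Hp := by
  rw [hH, hodge_add, hodge_fmul, fmul_const_mul, psi]

theorem KillingSpinor.isFluxDecomposition (hK : G.KillingSpinor ϕ H f) :
    G.IsFluxDecomposition H f (H - fmul (fun y => 1 / 14 * f y) G.form) := by
  have hH : H = fmul (fun y => 1 / 14 * f y) G.form +
      (H - fmul (fun y => 1 / 14 * f y) G.form) := by abel
  have hpsi := hK.star_f.trans (fwedge_psi_of_eq_fmul_form_add hH)
  rw [left_eq_add] at hpsi
  exact ⟨hH, hpsi, (G.hodge_fwedge_form _).trans hpsi⟩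

theorem IsFluxDecomposition.killingSpinor_iff_isTorsion (hD : G.IsFluxDecomposition H f Hp) :
    G.KillingSpinor ϕ H f ↔ G.IsTorsion (fun y => -(15 / 14) * f y) ((1 / 2 : ℝ) • dFun ϕ) 0
      (-Hp - (1 / 2 : ℝ) • G.contract (dFun ϕ) G.psi) := by
  have hform : (2 : ℝ) • (fwedge (dFun ϕ) G.form : Form Y 4) - G.hodge (k := 3) (q := 4) rfl H
      - fmul f G.psi = fmul (fun y => -(15 / 14) * f y) G.psi +
        (3 : ℝ) • (fwedge ((1 / 2 : ℝ) • dFun ϕ) G.form : Form Y 4) +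
          G.hodge (k := 3) (q := 4) rfl (-Hp - (1 / 2 : ℝ) • G.contract (dFun ϕ) G.psi) := by
    rw [hodge_neg_sub_half_contract_psi, hodge_of_eq_fmul_form_add hD.eq, fmul_const_mul,
      fwedge_smul_left]
    module
  have hpsi : (2 : ℝ) • (fwedge (dFun ϕ) G.psi : Form Y 5) =
      (4 : ℝ) • (fwedge ((1 / 2 : ℝ) • dFun ϕ) G.psi : Form Y 5) +
        G.hodge (k := 2) (q := 5) rfl 0 := by
    rw [hodge_zero, fwedge_smul_left]
    module
  have hdilaton : G.hodge (k := 1) (q := 6) rfl (dFun ϕ) =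
      -((1 / 2 : ℝ) • (fwedge H G.form : Form Y 6)) ↔
        (fwedge (-Hp - (1 / 2 : ℝ) • G.contract (dFun ϕ) G.psi) G.form : Form Y 6) = 0 := by
    rw [neg_sub_half_contract_psi_fwedge_form, fwedge_form_of_eq_fmul_form_add hD.eq, sub_eq_zero]
    constructor <;> intro h
    · rw [h]
      module
    · rw [neg_eq_iff_eq_neg.1 h]
      module
  exact ⟨fun hK => ⟨hK.d_form.trans hform, hK.d_psi.trans hpsi, fwedge_zero_left _,
      G.form_fwedge_hodge_neg_sub_half_contract_psi _ hD.wedge_psi, hdilaton.1 hK.star_d_dilaton⟩,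
    fun hT => ⟨hT.d_form.trans hform.symm, hT.d_psi.trans hpsi.symm,
      hdilaton.2 hT.three_wedge_form, by
        rw [fwedge_psi_of_eq_fmul_form_add hD.eq, hD.wedge_psi, add_zero]⟩⟩

end G2Structure

/-! ### The exterior derivative -/

section Leibniz

variable {V : Type*} [NormedAddCommGroup V] [NormedSpace ℝ V] {k : ℕ}

theorem extDeriv_smul_apply {g : V → ℝ} {θ : V → V [⋀^Fin k]→L[ℝ] ℝ} {z : V}
    (hg : DifferentiableAt ℝ g z) (hθ : DifferentiableAt ℝ θ z) (v : Fin (k + 1) → V)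
    (w : Fin (1 + k) → V) (hvw : v ∘ Fin.cast (Nat.add_comm 1 k) = w) :
    extDeriv (fun y => g y • θ y) z v =
      wedge (ContinuousAlternatingMap.ofSubsingleton ℝ V ℝ (0 : Fin 1) (fderiv ℝ g z)) (θ z) w +
        g z * extDeriv θ z v := by
  rw [wedge_one_apply _ _ v w hvw, extDeriv, fderiv_fun_smul hg hθ,
    ContinuousAlternatingMap.alternatizeUncurryFin_add,
    ContinuousAlternatingMap.alternatizeUncurryFin_smul,
    ContinuousAlternatingMap.add_apply, add_comm,
    ContinuousAlternatingMap.alternatizeUncurryFin_apply]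
  refine congrArg₂ _ (Finset.sum_congr rfl fun p _ => ?_) rfl
  simp only [zsmul_eq_mul, Int.cast_pow, Int.cast_neg, Int.cast_one]
  rfl

theorem contDiffAt_extDeriv {θ : V → V [⋀^Fin k]→L[ℝ] ℝ} {z : V} (hθ : ContDiffAt ℝ ∞ θ z) :
    ContDiffAt ℝ ∞ (extDeriv θ) z := by
  have halt := ContinuousLinearMap.contDiff (𝕜 := ℝ) (n := ∞) (E := V →L[ℝ] V [⋀^Fin k]→L[ℝ] ℝ)
    (F := V [⋀^Fin (k + 1)]→L[ℝ] ℝ) (ContinuousAlternatingMap.alternatizeUncurryFinCLM ℝ V ℝ)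
  exact halt.contDiffAt.comp z (hθ.fderiv_right (m := ∞) (by simp))

end Leibniz

section Charts

variable {Y : Type*} [TopologicalSpace Y] [ChartedSpace E7 Y] {k : ℕ}
  {e e' : OpenPartialHomeomorph Y E7}

/-- The derivative of a chart, as an endomorphism of the model space to which the tangent spaces
are definitionally equal. -/
noncomputable def chartDeriv (e : OpenPartialHomeomorph Y E7) (y : Y) : E7 →L[ℝ] E7 :=
  mfderiv (𝓡 7) (𝓡 7) e y

/-- The derivative of the inverse of a chart, as an endomorphism of the model space. -/
noncomputable def symmDeriv (e : OpenPartialHomeomorph Y E7) (z : E7) : E7 →L[ℝ] E7 :=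
  mfderiv (𝓡 7) (𝓡 7) e.symm z

/-- The value of a form at a point, as a form on the model space. -/
def Form.val (α : Form Y k) (y : Y) : E7 [⋀^Fin k]→L[ℝ] ℝ := α y

theorem inChart_apply (e : OpenPartialHomeomorph Y E7) (α : Form Y k) (z : E7) :
    inChart e α z = (α.val (e.symm z)).compContinuousLinearMap (symmDeriv e z) := rfl

theorem val_d (α : Form Y k) (x : Y) :
    (d α).val x = (extDeriv (inChart (chartAt E7 x) α) (chartAt E7 x x)).compContinuousLinearMap
      (chartDeriv (chartAt E7 x) x) := rfl

theorem IsSmooth.contDiffAt {α : Form Y k} (hα : IsSmooth α) (he : e ∈ atlas E7 Y) {z : E7}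
    (hz : z ∈ e.target) : ContDiffAt ℝ ∞ (inChart e α) z :=
  (hα e he).contDiffAt (e.open_target.mem_nhds hz)

theorem IsSmooth.differentiableAt {α : Form Y k} (hα : IsSmooth α) (x : Y) :
    DifferentiableAt ℝ (inChart (chartAt E7 x) α) (chartAt E7 x x) :=
  (hα.contDiffAt (chart_mem_atlas E7 x) (mem_chart_target E7 x)).differentiableAt (by simp)

theorem IsSmooth.const_smul {α : Form Y k} (hα : IsSmooth α) (c : ℝ) : IsSmooth (c • α) :=
  fun e he => (hα e he).const_smul c

theorem d_add {α β : Form Y k} (hα : IsSmooth α) (hβ : IsSmooth β) : d (α + β) = d α + d β := by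
  funext x
  have h : inChart (chartAt E7 x) (α + β) =
    inChart (chartAt E7 x) α + inChart (chartAt E7 x) β := rfl
  change (d (α + β)).val x = (d α).val x + (d β).val x
  rw [val_d, h, extDeriv_add (hα.differentiableAt x) (hβ.differentiableAt x)]
  rfl

theorem d_smul (c : ℝ) (α : Form Y k) : d (c • α) = c • d α := by
  funext x
  have h : inChart (chartAt E7 x) (c • α) = c • inChart (chartAt E7 x) α := rfl
  change (d (c • α)).val x = c • (d α).val x
  rw [val_d, h, extDeriv_smul]
  rfl

theorem contMDiff_exp_mul {g : Y → ℝ} (hg : ContMDiff (𝓡 7) 𝓘(ℝ, ℝ) ∞ g) (c : ℝ) :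
    ContMDiff (𝓡 7) 𝓘(ℝ, ℝ) ∞ fun y => Real.exp (c * g y) :=
  (show ContDiff ℝ ∞ fun t : ℝ => Real.exp (c * t) by fun_prop).contMDiff.comp hg

theorem two_le_infty : minSmoothness ℝ 2 ≤ (∞ : ℕ∞ω) := by
  rw [minSmoothness_of_isRCLikeNormedField]
  exact WithTop.coe_le_coe.2 (le_top : (2 : ℕ∞) ≤ ⊤)

variable [IsManifold (𝓡 7) ∞ Y]

theorem mdifferentiable_chart (he : e ∈ atlas E7 Y) : e.MDifferentiable (𝓡 7) (𝓡 7) :=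
  have : IsManifold (𝓡 7) 1 Y := IsManifold.of_le (n := ∞) (by simp)
  mdifferentiable_of_mem_atlas he

theorem symmDeriv_chartDeriv_apply (he : e ∈ atlas E7 Y) {y : Y} (hy : y ∈ e.source) (v : E7) :
    symmDeriv e (e y) (chartDeriv e y v) = v :=
  DFunLike.congr_fun ((mdifferentiable_chart he).symm_comp_deriv hy) v

theorem fderiv_transition (he : e ∈ atlas E7 Y) (he' : e' ∈ atlas E7 Y) {z : E7}
    (hz : z ∈ e.target) (hz' : e.symm z ∈ e'.source) :
    fderiv ℝ (e' ∘ e.symm) z = chartDeriv e' (e.symm z) ∘L symmDeriv e z := by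
  rw [← mfderiv_eq_fderiv]
  exact mfderiv_comp z ((mdifferentiable_chart he').mdifferentiableAt hz')
    ((mdifferentiable_chart he).mdifferentiableAt_symm hz)

theorem contDiffAt_transition (he : e ∈ atlas E7 Y) (he' : e' ∈ atlas E7 Y) {z : E7}
    (hz : z ∈ e.target) (hz' : e.symm z ∈ e'.source) :
    ContDiffAt ℝ ∞ (e' ∘ e.symm) z := by
  rw [← contMDiffAt_iff_contDiffAt]
  exact (contMDiffAt_of_mem_maximalAtlas (n := ∞) (IsManifold.subset_maximalAtlas he') hz').comp z
    (contMDiffAt_symm_of_mem_maximalAtlas (IsManifold.subset_maximalAtlas he) hz)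

theorem inChart_comp_chartDeriv (he : e ∈ atlas E7 Y) (α : Form Y k) {y : Y} (hy : y ∈ e.source) :
    (inChart e α (e y)).compContinuousLinearMap (chartDeriv e y) = α.val y := by
  rw [inChart_apply, e.left_inv hy]
  ext v
  exact congrArg (α.val y) (funext fun i => symmDeriv_chartDeriv_apply he hy (v i))

theorem inChart_eq_pullback (he : e ∈ atlas E7 Y) (he' : e' ∈ atlas E7 Y) (α : Form Y k)
    {z : E7} (hz : z ∈ e.target) (hz' : e.symm z ∈ e'.source) :
    inChart e α z = (inChart e' α ((e' ∘ e.symm) z)).compContinuousLinearMap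
      (fderiv ℝ (e' ∘ e.symm) z) := by
  rw [fderiv_transition he he' hz hz', inChart_apply, ← inChart_comp_chartDeriv he' α hz']
  rfl

theorem extDeriv_inChart_eq_pullback (he : e ∈ atlas E7 Y) (he' : e' ∈ atlas E7 Y)
    {α : Form Y k} {z : E7} (hz : z ∈ e.target) (hz' : e.symm z ∈ e'.source)
    (hα : DifferentiableAt ℝ (inChart e' α) ((e' ∘ e.symm) z)) :
    extDeriv (inChart e α) z = (extDeriv (inChart e' α) ((e' ∘ e.symm) z)).compContinuousLinearMap
      (fderiv ℝ (e' ∘ e.symm) z) := by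
  rw [← extDeriv_pullback (r := ∞) hα (contDiffAt_transition he he' hz hz') two_le_infty]
  apply Filter.EventuallyEq.extDeriv_eq
  filter_upwards [e.open_target.mem_nhds hz,
    (e.continuousAt_symm hz).eventually (e'.open_source.mem_nhds hz')] with w hw hw'
    using inChart_eq_pullback he he' α hw hw'

theorem inChart_d (he : e ∈ atlas E7 Y) {α : Form Y k} (hα : IsSmooth α) {z : E7}
    (hz : z ∈ e.target) : inChart e (d α) z = extDeriv (inChart e α) z := by
  have hz' := mem_chart_source E7 (e.symm z)
  have he' := chart_mem_atlas E7 (e.symm z)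
  rw [extDeriv_inChart_eq_pullback he he' hz hz' (hα.differentiableAt (e.symm z)),
    fderiv_transition he he' hz hz']
  rfl

theorem eventuallyEq_inChart_d (he : e ∈ atlas E7 Y) {α : Form Y k} (hα : IsSmooth α) {z : E7}
    (hz : z ∈ e.target) : inChart e (d α) =ᶠ[𝓝 z] extDeriv (inChart e α) := by
  filter_upwards [e.open_target.mem_nhds hz] with w hw using inChart_d he hα hw

theorem IsSmooth.d {α : Form Y k} (hα : IsSmooth α) : IsSmooth (d α) := fun _ he _ hz =>
  ((contDiffAt_extDeriv (hα.contDiffAt he hz)).congr_of_eventuallyEq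
    (eventuallyEq_inChart_d he hα hz)).contDiffWithinAt

theorem d_d {α : Form Y k} (hα : IsSmooth α) : d (d α) = 0 := by
  funext x
  have he := chart_mem_atlas E7 x
  have hz := mem_chart_target E7 x
  change (d (d α)).val x = 0
  rw [val_d, (eventuallyEq_inChart_d he hα hz).extDeriv_eq,
    extDeriv_extDeriv_apply (hα.contDiffAt he hz) two_le_infty]
  rfl

variable {g : Y → ℝ}

theorem contDiffAt_comp_symm (hg : ContMDiff (𝓡 7) 𝓘(ℝ, ℝ) ∞ g)
    (he : e ∈ atlas E7 Y) {z : E7} (hz : z ∈ e.target) : ContDiffAt ℝ ∞ (g ∘ e.symm) z := by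
  rw [← contMDiffAt_iff_contDiffAt]
  exact hg.contMDiffAt.comp z
    (contMDiffAt_symm_of_mem_maximalAtlas (IsManifold.subset_maximalAtlas he) hz)

theorem differentiableAt_comp_chartAt_symm (hg : ContMDiff (𝓡 7) 𝓘(ℝ, ℝ) ∞ g) (x : Y) :
    DifferentiableAt ℝ (g ∘ (chartAt E7 x).symm) (chartAt E7 x x) :=
  (contDiffAt_comp_symm hg (chart_mem_atlas E7 x) (mem_chart_target E7 x)).differentiableAt
    (by simp)

theorem IsSmooth.fmul {α : Form Y k} (hα : IsSmooth α) (hg : ContMDiff (𝓡 7) 𝓘(ℝ, ℝ) ∞ g) :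
    IsSmooth (fmul g α) := fun _ he _ hz =>
  ((contDiffAt_comp_symm hg he hz).smul (hα.contDiffAt he hz)).contDiffWithinAt

theorem val_dFun (hg : ContMDiff (𝓡 7) 𝓘(ℝ, ℝ) ∞ g) (x : Y) :
    (dFun g).val x = (ContinuousAlternatingMap.ofSubsingleton ℝ E7 ℝ (0 : Fin 1)
      (fderiv ℝ (g ∘ (chartAt E7 x).symm) (chartAt E7 x x))).compContinuousLinearMap
        (chartDeriv (chartAt E7 x) x) := by
  have he := chart_mem_atlas E7 x
  have hx := mem_chart_source E7 x
  have hcomp := mfderiv_comp (chartAt E7 x x) (hg.mdifferentiable (by simp) _)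
    ((mdifferentiable_chart he).mdifferentiableAt_symm (mem_chart_target E7 x))
  rw [← mfderiv_eq_fderiv, hcomp, (chartAt E7 x).left_inv hx]
  ext v
  exact (congrArg (mvfderiv (𝓡 7) g x) (symmDeriv_chartDeriv_apply he hx (v 0))).symm

theorem d_fmul_apply (hg : ContMDiff (𝓡 7) 𝓘(ℝ, ℝ) ∞ g) {α : Form Y k} (hα : IsSmooth α) (x : Y)
    (v : Fin (k + 1) → E7) (w : Fin (1 + k) → E7) (hvw : v ∘ Fin.cast (Nat.add_comm 1 k) = w) :
    (d (fmul g α)).val x v =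
      wedge ((dFun g).val x) (α.val x) w + g x * (d α).val x v := by
  have he := chart_mem_atlas E7 x
  have hx := mem_chart_source E7 x
  set D := chartDeriv (chartAt E7 x) x
  have hleib := extDeriv_smul_apply (differentiableAt_comp_chartAt_symm hg x)
    (hα.differentiableAt x) (D ∘ v) (D ∘ w) (by rw [← hvw]; rfl)
  rw [Function.comp_apply, (chartAt E7 x).left_inv hx] at hleib
  rw [val_dFun hg, ← inChart_comp_chartDeriv he α hx, ← wedge_compContinuousLinearMap]
  exact hleib

theorem d_fmul_three (hg : ContMDiff (𝓡 7) 𝓘(ℝ, ℝ) ∞ g) {α : Form Y 3} (hα : IsSmooth α) :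
    (d (fmul g α) : Form Y 4) = (fwedge (dFun g) α : Form Y 4) + fmul g (d α) :=
  funext fun x => ContinuousAlternatingMap.ext fun v => d_fmul_apply hg hα x v v rfl

theorem d_fmul_four (hg : ContMDiff (𝓡 7) 𝓘(ℝ, ℝ) ∞ g) {α : Form Y 4} (hα : IsSmooth α) :
    (d (fmul g α) : Form Y 5) = (fwedge (dFun g) α : Form Y 5) + fmul g (d α) := by
  funext x
  ext v
  have h := d_fmul_apply (k := 4) hg hα x v v rfl
  rw [Pi.add_apply, ContinuousAlternatingMap.add_apply,
    show (fwedge (dFun g) α : Form Y 5) x = wedge ((dFun g).val x) (α.val x) from rfl]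
  generalize wedge ((dFun g).val x) (α.val x) = W at h ⊢
  exact h

theorem dFun_exp_mul (hg : ContMDiff (𝓡 7) 𝓘(ℝ, ℝ) ∞ g) (c : ℝ) :
    dFun (fun y => Real.exp (c * g y)) = fmul (fun y => c * Real.exp (c * g y)) (dFun g) := by
  funext x
  have hexp : fderiv ℝ ((fun y => Real.exp (c * g y)) ∘ (chartAt E7 x).symm) (chartAt E7 x x) =
      (c * Real.exp (c * g x)) • fderiv ℝ (g ∘ (chartAt E7 x).symm) (chartAt E7 x x) := by
    refine ((differentiableAt_comp_chartAt_symm hg x).hasFDerivAt.const_mul c).exp.fderiv.trans ?_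
    rw [Function.comp_apply, (chartAt E7 x).left_inv (mem_chart_source E7 x), smul_smul, mul_comm]
  change (dFun fun y => Real.exp (c * g y)).val x = (c * Real.exp (c * g x)) • (dFun g).val x
  rw [val_dFun (contMDiff_exp_mul hg c), val_dFun hg, hexp]
  rfl

end Charts

/-! ### Change of frame -/

theorem compContinuousLinearMap_eq_det_smul {V : Type*} [NormedAddCommGroup V] [NormedSpace ℝ V]
    [FiniteDimensional ℝ V] {n : ℕ} (hn : Module.finrank ℝ V = n) (η : V [⋀^Fin n]→L[ℝ] ℝ)
    (A : V →L[ℝ] V) : η.compContinuousLinearMap A = A.det • η := by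
  ext v
  have hη := η.toAlternatingMap.eq_smul_basis_det (Module.finBasisOfFinrankEq ℝ V hn)
  have hηA := congrArg (fun ξ => ξ (A ∘ v)) hη
  have hηv := congrArg (fun ξ => ξ v) hη
  have hdet := (Module.finBasisOfFinrankEq ℝ V hn).det_comp (A : V →ₗ[ℝ] V) v
  simp only [AlternatingMap.smul_apply, smul_eq_mul] at hηA hηv
  refine hηA.trans ?_
  refine (congrArg (_ * ·) hdet).trans ((mul_left_comm _ _ _).trans ?_)
  exact congrArg (A.det * ·) hηv.symm

theorem det_adjoint {V : Type*} [NormedAddCommGroup V] [InnerProductSpace ℝ V]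
    [FiniteDimensional ℝ V] (A : V →L[ℝ] V) :
    (ContinuousLinearMap.adjoint A).det = A.det := by
  have b := stdOrthonormalBasis ℝ V
  have hM := LinearMap.toMatrix_adjoint b b (A : V →ₗ[ℝ] V)
  have hdet := congrArg Matrix.det hM
  rw [Matrix.det_conjTranspose, LinearMap.det_toMatrix, LinearMap.det_toMatrix] at hdet
  exact hdet

theorem det_smul_eq_pow_finrank {V : Type*} [NormedAddCommGroup V] [NormedSpace ℝ V] (c : ℝ)
    (A : V →L[ℝ] V) : (c • A).det = c ^ Module.finrank ℝ V * A.det :=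
  LinearMap.det_smul c (A : V →ₗ[ℝ] V)

theorem sum_smul_basisVec (u : E7) : ∑ i, u i • basisVec i = u := by
  simpa [basisVec] using (EuclideanSpace.basisFun (Fin 7) ℝ).sum_repr u

theorem inner_basisVec_right (u : E7) (i : Fin 7) : inner ℝ u (basisVec i) = u i := by
  simp [basisVec, EuclideanSpace.inner_single_right]

theorem adjoint_basisVec_apply (A : E7 →L[ℝ] E7) (i j : Fin 7) :
    ContinuousLinearMap.adjoint A (basisVec i) j = A (basisVec j) i := by
  rw [← inner_basisVec_right, ContinuousLinearMap.adjoint_inner_left, real_inner_comm,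
    inner_basisVec_right]

section Forms

variable {k q : ℕ}

theorem apply_eq_sum_basisTuple (α : E7 [⋀^Fin k]→L[ℝ] ℝ) (v : Fin k → E7) :
    α v = ∑ I : Fin k → Fin 7, (∏ a, v a (I a)) * α (basisTuple I) := by
  conv_lhs => rw [← funext fun a => sum_smul_basisVec (v a)]
  refine (α.toMultilinearMap.map_sum _).trans (Finset.sum_congr rfl fun I _ => ?_)
  exact α.toMultilinearMap.map_smul_univ _ _

theorem formInner_add_left (α α' β : E7 [⋀^Fin k]→L[ℝ] ℝ) :
    formInner (α + α') β = formInner α β + formInner α' β := by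
  simp only [formInner, ContinuousAlternatingMap.add_apply, add_mul, Finset.sum_add_distrib,
    mul_add]

theorem formInner_smul_left (c : ℝ) (α β : E7 [⋀^Fin k]→L[ℝ] ℝ) :
    formInner (c • α) β = c * formInner α β := by
  simp only [formInner, ContinuousAlternatingMap.smul_apply, smul_eq_mul, mul_assoc,
    ← Finset.mul_sum]
  exact mul_left_comm _ _ _

theorem formInner_compContinuousLinearMap (α β : E7 [⋀^Fin k]→L[ℝ] ℝ) (A : E7 →L[ℝ] E7) :
    formInner (α.compContinuousLinearMap A) β =
      formInner α (β.compContinuousLinearMap (ContinuousLinearMap.adjoint A)) := by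
  have hαA (I : Fin k → Fin 7) : α.compContinuousLinearMap A (basisTuple I) =
      ∑ J : Fin k → Fin 7, (∏ a, A (basisVec (I a)) (J a)) * α (basisTuple J) :=
    apply_eq_sum_basisTuple α _
  have hβA (J : Fin k → Fin 7) :
      β.compContinuousLinearMap (ContinuousLinearMap.adjoint A) (basisTuple J) =
        ∑ I : Fin k → Fin 7, (∏ a, A (basisVec (I a)) (J a)) * β (basisTuple I) := by
    refine (apply_eq_sum_basisTuple β _).trans (Finset.sum_congr rfl fun I _ => ?_)
    exact congrArg (· * _) (Finset.prod_congr rfl fun a _ => adjoint_basisVec_apply A _ _)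
  simp only [formInner, hαA, hβA, Finset.sum_mul, Finset.mul_sum]
  rw [Finset.sum_comm]
  exact Finset.sum_congr rfl fun J _ => Finset.sum_congr rfl fun I _ => by ring

theorem ext_formInner {α β : E7 [⋀^Fin k]→L[ℝ] ℝ}
    (h : ∀ γ : E7 [⋀^Fin k]→L[ℝ] ℝ, formInner α γ = formInner β γ) : α = β := by
  have hsq : ∑ I : Fin k → Fin 7, (α (basisTuple I) - β (basisTuple I)) ^ 2 = 0 := by
    have hsub := sub_eq_zero.mpr (h (α - β))
    rw [formInner, formInner, ← mul_sub, ← Finset.sum_sub_distrib] at hsub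
    rw [← (mul_eq_zero.mp hsub).resolve_left (by positivity)]
    exact Finset.sum_congr rfl fun I _ => by
      rw [ContinuousAlternatingMap.sub_apply]
      ring
  refine ext_basisTuple fun I _ => ?_
  have hI := (Finset.sum_eq_zero_iff_of_nonneg fun _ _ => sq_nonneg _).mp hsq I (Finset.mem_univ I)
  exact sub_eq_zero.mp (pow_eq_zero_iff two_ne_zero |>.mp hI)

theorem hodge0_constOfIsEmpty_ne_zero (h : 0 + q = 7) :
    hodge0 h (ContinuousAlternatingMap.constOfIsEmpty ℝ E7 (Fin 0) 1) ≠ 0 := by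
  rw [← (isLinearMap_hodge0 h).map_zero, (hodge0_injective h).ne_iff]
  exact fun hone => one_ne_zero (α := ℝ) (congrArg (fun η => η 0) hone)

theorem formInner_hodge0_compContinuousLinearMap (h : k + q = 7) (α : E7 [⋀^Fin k]→L[ℝ] ℝ)
    (β : E7 [⋀^Fin q]→L[ℝ] ℝ) (A : E7 →L[ℝ] E7) :
    formInner (hodge0 h (α.compContinuousLinearMap A)) (β.compContinuousLinearMap A) =
      A.det * formInner (hodge0 h α) β := by
  have hwedge : wedge (α.compContinuousLinearMap A) (β.compContinuousLinearMap A) =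
      A.det • wedge α β := by
    rw [← wedge_compContinuousLinearMap]
    exact compContinuousLinearMap_eq_det_smul (by simp [h]) _ A
  rw [wedge_eq_formInner_smul h, wedge_eq_formInner_smul h, smul_smul] at hwedge
  exact smul_left_injective ℝ (hodge0_constOfIsEmpty_ne_zero _) hwedge

theorem hodge0_compContinuousLinearMap_adjoint (h : k + q = 7) (α : E7 [⋀^Fin k]→L[ℝ] ℝ)
    (A : E7 →L[ℝ] E7) :
    (hodge0 h (α.compContinuousLinearMap A)).compContinuousLinearMap
      (ContinuousLinearMap.adjoint A) = A.det • hodge0 h α := by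
  refine ext_formInner fun β => ?_
  rw [formInner_compContinuousLinearMap, ContinuousLinearMap.adjoint_adjoint,
    formInner_hodge0_compContinuousLinearMap, formInner_smul_left]

end Forms

/-! ### The four-form as a function of the three-form -/

/-- Bryant's bilinear form of a three-form `θ`: the coefficient of the standard volume form in
`θ ∧ (u ⌟ θ) ∧ (v ⌟ θ)`, written through the Hodge star. For `θ = phi0` it is six times the
Euclidean inner product. -/
noncomputable def formMetric (θ : E7 [⋀^Fin 3]→L[ℝ] ℝ) : E7 →ₗ[ℝ] E7 →ₗ[ℝ] ℝ :=
  LinearMap.mk₂ ℝ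
    (fun u v => formInner (wedge (k := 2) (l := 2) (θ.curryLeft u) (θ.curryLeft v))
      (hodge0 (k := 3) (q := 2 + 2) rfl θ))
    (fun u u' v => by rw [map_add, wedge_add_left, formInner_add_left])
    (fun c u v => by rw [map_smul, wedge_smul_left, formInner_smul_left, smul_eq_mul])
    (fun u v v' => by rw [map_add, wedge_add_right, formInner_add_left])
    (fun c u v => by rw [map_smul, wedge_smul_right, formInner_smul_left, smul_eq_mul])

theorem formMetric_apply (θ : E7 [⋀^Fin 3]→L[ℝ] ℝ) (u v : E7) :
    formMetric θ u v = formInner (wedge (k := 2) (l := 2) (θ.curryLeft u) (θ.curryLeft v))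
      (hodge0 (k := 3) (q := 2 + 2) rfl θ) := rfl

theorem formMetric_compContinuousLinearMap (θ : E7 [⋀^Fin 3]→L[ℝ] ℝ) (A : E7 →L[ℝ] E7)
    (u v : E7) :
    formMetric (θ.compContinuousLinearMap A) u v = A.det * formMetric θ (A u) (A v) := by
  have hcurry (w : E7) : (θ.compContinuousLinearMap A).curryLeft w =
      (θ.curryLeft (A w)).compContinuousLinearMap A :=
    ContinuousAlternatingMap.curryLeft_compContinuousLinearMap θ A w
  rw [formMetric_apply, formMetric_apply, hcurry, hcurry, ← wedge_compContinuousLinearMap,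
    formInner_comm, formInner_hodge0_compContinuousLinearMap, formInner_comm]

theorem formMetric_phi0_basisVec (i j : Fin 7) :
    formMetric phi0 (basisVec i) (basisVec j) = 6 * delta i j := by
  have hcurry (m a b : Fin 7) :
      phi0.curryLeft (basisVec m) (basisTuple ![a, b]) = (phiCoeff m a b : ℝ) := by
    rw [← phi0_basisTuple]
    refine congrArg phi0 (funext fun n => ?_)
    fin_cases n <;> rfl
  have hstar (a b c d : Fin 7) : hodge0 (k := 3) (q := 2 + 2) rfl phi0
      (Fin.append (basisTuple ![a, b]) (basisTuple ![c, d])) = (psiCoeff a b c d : ℝ) := by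
    rw [← psi0_basisTuple, ← basisTuple_append]
    refine congrArg psi0 (congrArg basisTuple (funext fun n => ?_))
    fin_cases n <;> rfl
  have hsum : ∑ c : Fin 7, ∑ d : Fin 7, phiCoeff j c d *
      ∑ a : Fin 7, ∑ b : Fin 7, phiCoeff i a b * psiCoeff a b c d = 4 * (6 * delta j i) := by
    simp only [sum_phiCoeff_mul_psiCoeff, mul_left_comm _ (4 : ℤ), ← Finset.mul_sum,
      sum_phiCoeff_mul_phiCoeff]
  have hcast := congrArg (Int.cast (R := ℝ)) hsum
  push_cast at hcast
  rw [formMetric_apply, formInner_wedge, sum_tuple_two]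
  simp only [sum_tuple_two (fun _ => _ * hodge0 _ _ _), hcurry, hstar]
  simp only [mul_left_comm _ (2 ! : ℝ)⁻¹, ← Finset.mul_sum, hcast]
  simp only [cast_delta, eq_comm]
  norm_num

theorem formMetric_phi0 (u v : E7) : formMetric phi0 u v = 6 * inner ℝ u v := by
  have hbasis : formMetric phi0 = (6 : ℝ) • innerₗ E7 := by
    refine LinearMap.ext_basis stdBasis stdBasis fun i j => ?_
    rw [coe_stdBasis, formMetric_phi0_basisVec, LinearMap.smul_apply,
      LinearMap.smul_apply, innerₗ_apply_apply, inner_basisVec_right, basisVec_apply, smul_eq_mul]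
  rw [hbasis]
  rfl

/-- The operator `M` with `6 ⟪M u, v⟫ = formMetric θ u v`, so that `metricOp phi0` is the identity.
For `θ` the pullback of `phi0` by `A` it is `det A • A† ∘ A`. -/
noncomputable def metricOp (θ : E7 [⋀^Fin 3]→L[ℝ] ℝ) : E7 →L[ℝ] E7 :=
  LinearMap.toContinuousLinearMap
    ((6 : ℝ)⁻¹ • ∑ j, ((formMetric θ).flip (basisVec j)).smulRight (basisVec j))

theorem metricOp_apply (θ : E7 [⋀^Fin 3]→L[ℝ] ℝ) (u : E7) (j : Fin 7) :
    metricOp θ u j = 6⁻¹ * formMetric θ u (basisVec j) := by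
  simp [metricOp, basisVec, Finset.sum_apply, Pi.single_apply]

theorem metricOp_phi0_compContinuousLinearMap (A : E7 →L[ℝ] E7) :
    metricOp (phi0.compContinuousLinearMap A) =
      A.det • (ContinuousLinearMap.adjoint A ∘L A) := by
  ext u j
  rw [metricOp_apply, formMetric_compContinuousLinearMap, formMetric_phi0, _root_.smul_apply,
    PiLp.smul_apply, ContinuousLinearMap.comp_apply, ← inner_basisVec_right,
    ContinuousLinearMap.adjoint_inner_left, smul_eq_mul]
  ring

theorem det_metricOp_phi0_compContinuousLinearMap (A : E7 →L[ℝ] E7) :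
    (metricOp (phi0.compContinuousLinearMap A)).det = A.det ^ 9 := by
  have hcomp : (ContinuousLinearMap.adjoint A ∘L A).det = A.det * A.det :=
    (LinearMap.det_comp _ _).trans (congrArg (· * A.det) (det_adjoint A))
  rw [metricOp_phi0_compContinuousLinearMap, det_smul_eq_pow_finrank, finrank_euclideanSpace_fin,
    hcomp]
  ring

/-- The four-form `*θ` of the metric and orientation of a positive three-form `θ`, as an explicit
function of `θ`. If `θ` is the pullback of `phi0` by an isomorphism `A`, then pulling `hodge0 θ`
back by `metricOp θ` gives `(det A)⁵` times the pullback of `psi0`, whereas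
`det (metricOp θ) = (det A)⁹`; hence the scalar factor, which is `(det A)⁻⁵`. -/
noncomputable def psiOf (θ : E7 [⋀^Fin 3]→L[ℝ] ℝ) : E7 [⋀^Fin 4]→L[ℝ] ℝ :=
  (((metricOp θ).det ^ 2) ^ (2 / 9 : ℝ) / (metricOp θ).det) •
    (hodge0 (k := 3) (q := 4) rfl θ).compContinuousLinearMap (metricOp θ)

theorem hodge0_compContinuousLinearMap_metricOp (A : E7 →L[ℝ] E7) :
    (hodge0 (k := 3) (q := 4) rfl (phi0.compContinuousLinearMap A)).compContinuousLinearMap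
      (metricOp (phi0.compContinuousLinearMap A)) =
        A.det ^ 5 • psi0.compContinuousLinearMap A := by
  have hadjoint := congrArg (fun η => ContinuousAlternatingMap.compContinuousLinearMap η A)
    (hodge0_compContinuousLinearMap_adjoint (k := 3) (q := 4) rfl phi0 A)
  rw [metricOp_phi0_compContinuousLinearMap]
  ext v
  have hsmul := (hodge0 (k := 3) (q := 4) rfl
    (phi0.compContinuousLinearMap A)).toMultilinearMap.map_smul_univ (fun _ => A.det)
      fun i => ContinuousLinearMap.adjoint A (A (v i))
  rw [Finset.prod_const, Finset.card_fin] at hsmul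
  refine hsmul.trans ((congrArg (A.det ^ 4 • ·) (congrArg (fun η => η v) hadjoint)).trans ?_)
  change A.det ^ 4 * (A.det * psi0 (A ∘ v)) = A.det ^ 5 * psi0 (A ∘ v)
  ring

theorem psiOf_phi0_compContinuousLinearMap {A : E7 →L[ℝ] E7} (hA : A.det ≠ 0) :
    psiOf (phi0.compContinuousLinearMap A) = psi0.compContinuousLinearMap A := by
  have hrpow : ((A.det ^ 9) ^ 2) ^ (2 / 9 : ℝ) = A.det ^ 4 := by
    have hpow : (A.det ^ 9) ^ 2 = (A.det ^ 2) ^ (9 : ℝ) := by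
      rw [← pow_mul, mul_comm, pow_mul]
      norm_cast
    rw [hpow, ← Real.rpow_mul (by positivity)]
    norm_num
    ring
  have hscale : A.det ^ 4 / A.det ^ 9 * A.det ^ 5 = 1 := by field_simp
  rw [psiOf, det_metricOp_phi0_compContinuousLinearMap, hrpow,
    hodge0_compContinuousLinearMap_metricOp, smul_smul, hscale, one_smul]

/-! ### Smoothness of the four-form -/

section Smoothness

variable {X : Type*} [NormedAddCommGroup X] [NormedSpace ℝ X] {n : ℕ∞ω} {k l q : ℕ}

theorem contDiff_alternating_apply (v : Fin k → E7) {α : X → E7 [⋀^Fin k]→L[ℝ] ℝ}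
    (hα : ContDiff ℝ n α) : ContDiff ℝ n fun x => α x v :=
  (ContinuousAlternatingMap.apply ℝ E7 ℝ v).contDiff.comp hα

theorem contDiff_of_contDiff_basisTuple {α : X → E7 [⋀^Fin k]→L[ℝ] ℝ}
    (hα : ∀ I, ContDiff ℝ n fun x => α x (basisTuple I)) : ContDiff ℝ n α := by
  let coords : (E7 [⋀^Fin k]→L[ℝ] ℝ) →ₗ[ℝ] (Fin k → Fin 7) → ℝ :=
    { toFun := fun η I => η (basisTuple I)
      map_add' := fun _ _ => rfl
      map_smul' := fun _ _ => rfl }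
  obtain ⟨recover, hrecover⟩ := coords.exists_leftInverse_of_injective <|
    LinearMap.ker_eq_bot.mpr fun _ _ h => ext_basisTuple fun I _ => congrFun h I
  have hα' : α = recover.toContinuousLinearMap ∘ fun x I => α x (basisTuple I) := by
    funext x
    exact (LinearMap.congr_fun hrecover (α x)).symm
  rw [hα']
  exact recover.toContinuousLinearMap.contDiff.comp (contDiff_pi.mpr hα)

theorem contDiff_hodge0 (h : k + q = 7) {α : X → E7 [⋀^Fin k]→L[ℝ] ℝ} (hα : ContDiff ℝ n α) :
    ContDiff ℝ n fun x => hodge0 h (α x) := by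
  refine contDiff_of_contDiff_basisTuple fun J => ?_
  simp only [hodge0_apply]
  exact contDiff_const.mul <| ContDiff.sum fun I _ =>
    (contDiff_alternating_apply _ hα).mul contDiff_const

theorem contDiff_wedge {α : X → E7 [⋀^Fin k]→L[ℝ] ℝ} {β : X → E7 [⋀^Fin l]→L[ℝ] ℝ}
    (hα : ContDiff ℝ n α) (hβ : ContDiff ℝ n β) : ContDiff ℝ n fun x => wedge (α x) (β x) := by
  refine contDiff_of_contDiff_basisTuple fun I => ?_
  simp only [wedge_apply]
  exact contDiff_const.mul <| ContDiff.sum fun σ _ => contDiff_const.mul <|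
    (contDiff_alternating_apply _ hα).mul (contDiff_alternating_apply _ hβ)

theorem contDiff_formInner {α β : X → E7 [⋀^Fin k]→L[ℝ] ℝ} (hα : ContDiff ℝ n α)
    (hβ : ContDiff ℝ n β) : ContDiff ℝ n fun x => formInner (α x) (β x) :=
  contDiff_const.mul <| ContDiff.sum fun _ _ =>
    (contDiff_alternating_apply _ hα).mul (contDiff_alternating_apply _ hβ)

theorem contDiff_formMetric (u v : E7) : ContDiff ℝ n fun θ => formMetric θ u v := by
  have hcurry (w : E7) : ContDiff ℝ n fun θ : E7 [⋀^Fin 3]→L[ℝ] ℝ => θ.curryLeft w :=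
    contDiff_of_contDiff_basisTuple fun I =>
      contDiff_alternating_apply (Fin.cons w (basisTuple I)) contDiff_id
  exact contDiff_formInner (contDiff_wedge (hcurry u) (hcurry v)) (contDiff_hodge0 _ contDiff_id)

theorem contDiff_metricOp_apply (u : E7) (j : Fin 7) : ContDiff ℝ n fun θ => metricOp θ u j := by
  simp only [metricOp_apply]
  exact contDiff_const.mul (contDiff_formMetric u (basisVec j))

theorem contDiff_compContinuousLinearMap {α : X → E7 [⋀^Fin k]→L[ℝ] ℝ} {A : X → E7 →L[ℝ] E7}
    (hα : ContDiff ℝ n α) (hA : ∀ u j, ContDiff ℝ n fun x => A x u j) :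
    ContDiff ℝ n fun x => (α x).compContinuousLinearMap (A x) := by
  refine contDiff_of_contDiff_basisTuple fun I => ?_
  simp only [ContinuousAlternatingMap.compContinuousLinearMap_apply,
    apply_eq_sum_basisTuple _ (_ ∘ _)]
  exact ContDiff.sum fun J _ => (contDiff_prod fun a _ => hA (basisTuple I a) (J a)).mul
    (contDiff_alternating_apply _ hα)

theorem contDiff_det {A : X → E7 →L[ℝ] E7} (hA : ∀ u j, ContDiff ℝ n fun x => A x u j) :
    ContDiff ℝ n fun x => (A x).det := by
  have hdet (x : X) : (A x).det = ∑ σ : Equiv.Perm (Fin 7),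
      ((Equiv.Perm.sign σ : ℤ) : ℝ) * ∏ i, A x (stdBasis i) (σ i) := by
    rw [ContinuousLinearMap.det, ← LinearMap.det_toMatrix stdBasis, Matrix.det_apply']
    simp [LinearMap.toMatrix_apply]
  simp only [hdet]
  exact ContDiff.sum fun σ _ => contDiff_const.mul (contDiff_prod fun i _ => hA _ _)

theorem contDiffAt_psiOf {θ : E7 [⋀^Fin 3]→L[ℝ] ℝ} (hθ : (metricOp θ).det ≠ 0) :
    ContDiffAt ℝ n psiOf θ := by
  have hdet : ContDiffAt ℝ n (fun η => (metricOp η).det) θ :=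
    (contDiff_det contDiff_metricOp_apply).contDiffAt
  exact (((hdet.pow 2).rpow_const_of_ne (pow_ne_zero 2 hθ)).div hdet hθ).smul
    (contDiff_compContinuousLinearMap (contDiff_hodge0 _ contDiff_id)
      contDiff_metricOp_apply).contDiffAt

end Smoothness

/-! ### Smoothness of `ψ` and the flux equation of motion -/

namespace G2Structure

variable {Y : Type*} [TopologicalSpace Y] [ChartedSpace E7 Y]

/-- The adapted frame at a point, with the tangent space identified with the model space. -/
noncomputable def frameEquiv (G : G2Structure Y) (y : Y) : E7 ≃L[ℝ] E7 := G.frame y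

/-- The adapted frame expressed in a chart. -/
noncomputable def chartFrame (G : G2Structure Y) (e : OpenPartialHomeomorph Y E7) (z : E7) :
    E7 →L[ℝ] E7 :=
  (G.frameEquiv (e.symm z) : E7 →L[ℝ] E7) ∘L symmDeriv e z

variable {G : G2Structure Y} {e : OpenPartialHomeomorph Y E7}

theorem inChart_form (z : E7) :
    inChart e G.form z = phi0.compContinuousLinearMap (G.chartFrame e z) := by
  rw [inChart_apply, show G.form.val (e.symm z) = _ from G.form_apply (e.symm z)]
  rfl

theorem inChart_psi (z : E7) :
    inChart e G.psi z = psi0.compContinuousLinearMap (G.chartFrame e z) := by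
  rw [inChart_apply, show G.psi.val (e.symm z) = _ from G.psi_apply (e.symm z)]
  generalize psi0 = θ
  rfl

variable [IsManifold (𝓡 7) ∞ Y]

theorem det_chartFrame_ne_zero (he : e ∈ atlas E7 Y) {z : E7} (hz : z ∈ e.target) :
    (G.chartFrame e z).det ≠ 0 := by
  set u := G.frameEquiv (e.symm z)
  have hright : (G.chartFrame e z).toLinearMap ∘ₗ
      (chartDeriv e (e.symm z) ∘L (u.symm : E7 →L[ℝ] E7)).toLinearMap = LinearMap.id := by
    ext1 v
    have hsymm := symmDeriv_chartDeriv_apply he (e.map_target hz) (u.symm v)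
    rw [e.right_inv hz] at hsymm
    exact (congrArg u hsymm).trans (u.apply_symm_apply v)
  have hdet := congrArg LinearMap.det hright
  rw [LinearMap.det_comp, LinearMap.det_id] at hdet
  exact left_ne_zero_of_mul_eq_one hdet

theorem isSmooth_psi : IsSmooth G.psi := fun e he z hz => by
  have hpsi : inChart e G.psi =ᶠ[𝓝 z] psiOf ∘ inChart e G.form := by
    filter_upwards [e.open_target.mem_nhds hz] with w hw
    rw [Function.comp_apply, inChart_form, inChart_psi,
      psiOf_phi0_compContinuousLinearMap (det_chartFrame_ne_zero he hw)]
  have hmetric : (metricOp (inChart e G.form z)).det ≠ 0 := by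
    rw [inChart_form, det_metricOp_phi0_compContinuousLinearMap]
    exact pow_ne_zero 9 (det_chartFrame_ne_zero he hz)
  exact (((contDiffAt_psiOf hmetric).comp z (G.smooth.contDiffAt he hz)).congr_of_eventuallyEq
    hpsi).contDiffWithinAt

variable {ϕ f : Y → ℝ} {H : Form Y 3}

theorem KillingSpinor.d_exp_psi (hK : G.KillingSpinor ϕ H f) (hϕ : ContMDiff (𝓡 7) 𝓘(ℝ, ℝ) ∞ ϕ) :
    d (fmul (fun y => Real.exp (-2 * ϕ y)) G.psi) = 0 := by
  rw [d_fmul_four (contMDiff_exp_mul hϕ (-2)) isSmooth_psi, dFun_exp_mul hϕ, hK.d_psi,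
    fwedge_fmul_left]
  generalize (fwedge (dFun ϕ) G.psi : Form Y 5) = X
  funext x
  change (-2 * Real.exp (-2 * ϕ x)) • X x + Real.exp (-2 * ϕ x) • (2 : ℝ) • X x = 0
  module

theorem KillingSpinor.exp_hodge_flux (hK : G.KillingSpinor ϕ H f)
    (hϕ : ContMDiff (𝓡 7) 𝓘(ℝ, ℝ) ∞ ϕ) :
    fmul (fun y => Real.exp (-2 * ϕ y)) (G.hodge (k := 3) (q := 4) rfl H) =
      (-1 : ℝ) • d (fmul (fun y => Real.exp (-2 * ϕ y)) G.form) +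
        fmul (fun y => -f y) (fmul (fun y => Real.exp (-2 * ϕ y)) G.psi) := by
  rw [d_fmul_three (contMDiff_exp_mul hϕ (-2)) G.smooth, dFun_exp_mul hϕ, hK.d_form,
    fwedge_fmul_left]
  generalize (fwedge (dFun ϕ) G.form : Form Y 4) = X
  generalize G.hodge (k := 3) (q := 4) rfl H = Z
  funext x
  change Real.exp (-2 * ϕ x) • Z x = (-1 : ℝ) • ((-2 * Real.exp (-2 * ϕ x)) • X x +
    Real.exp (-2 * ϕ x) • ((2 : ℝ) • X x - Z x - f x • G.psi x)) +
      (-f x) • Real.exp (-2 * ϕ x) • G.psi x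
  module

theorem KillingSpinor.fluxEOM (hK : G.KillingSpinor ϕ H f) (hϕ : ContMDiff (𝓡 7) 𝓘(ℝ, ℝ) ∞ ϕ)
    (hf : ∃ c, ∀ y, f y = c) : G.FluxEOM ϕ H := by
  obtain ⟨c, hc⟩ := hf
  obtain rfl : f = fun _ => c := funext hc
  have hexp := contMDiff_exp_mul hϕ (-2)
  have hform := G.smooth.fmul hexp
  have hconst : fmul (fun _ : Y => -c) (fmul (fun y => Real.exp (-2 * ϕ y)) G.psi) =
    (-c) • fmul (fun y => Real.exp (-2 * ϕ y)) G.psi := rfl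
  rw [FluxEOM, hodge_fmul, hK.exp_hodge_flux hϕ, hconst,
    d_add (hform.d.const_smul (-1)) ((isSmooth_psi.fmul hexp).const_smul (-c)),
    d_smul, d_smul, hK.d_exp_psi hϕ, smul_zero, add_zero]
  exact (congrArg ((-1 : ℝ) • ·) (d_d hform)).trans (smul_zero _)

end G2Structure

end HetG2


open HetG2 in
theorem mainTheorem4_general {Y : Type*} [TopologicalSpace Y] [ChartedSpace E7 Y]
    [IsManifold (𝓡 7) ∞ Y] (G : G2Structure Y) (ϕ f : Y → ℝ) (H : Form Y 3)
    (hϕ : ContMDiff (𝓡 7) 𝓘(ℝ, ℝ) ∞ ϕ) :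
    (G.KillingSpinor ϕ H f ↔
      ∃ (Hp : Form Y 3) (τ₀ : Y → ℝ) (τ₁ : Form Y 1) (τ₂ : Form Y 2) (τ₃ : Form Y 3),
        G.IsFluxDecomposition H f Hp ∧ G.IsTorsion τ₀ τ₁ τ₂ τ₃ ∧
        (∀ y, τ₀ y = -(15 / 14) * f y) ∧
        τ₁ = (1 / 2 : ℝ) • dFun ϕ ∧
        τ₂ = 0 ∧
        τ₃ = -Hp - (1 / 2 : ℝ) • G.contract (dFun ϕ) G.psi ∧
        G.hodge (k := 3) (q := 4) rfl τ₃ =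
          -G.hodge (k := 3) (q := 4) rfl Hp
            + (1 / 2 : ℝ) • (fwedge (dFun ϕ) G.form : Form Y 4)) ∧
    (G.KillingSpinor ϕ H f → (∃ c, ∀ y, f y = c) → G.FluxEOM ϕ H) := by
  refine ⟨⟨fun hK => ?_, ?_⟩, fun hK hf => hK.fluxEOM hϕ hf⟩
  · have hD := hK.isFluxDecomposition
    exact ⟨_, _, _, _, _, hD, hD.killingSpinor_iff_isTorsion.1 hK, fun _ => rfl, rfl, rfl, rfl,
      G.hodge_neg_sub_half_contract_psi _ _⟩
  · rintro ⟨Hp, τ₀, τ₁, τ₂, τ₃, hD, hT, h₀, rfl, rfl, rfl, -⟩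
    obtain rfl : τ₀ = fun y => -(15 / 14) * f y := funext h₀
    exact hD.killingSpinor_iff_isTorsion.2 hT

open HetG2 in
theorem mainTheorem4 {Y : Type*} [TopologicalSpace Y] [ChartedSpace E7 Y] [IsManifold (𝓡 7) ∞ Y]
    (G : G2Structure Y) (ϕ f : Y → ℝ) (H : Form Y 3)
    (hϕ : ContMDiff (𝓡 7) 𝓘(ℝ, ℝ) ∞ ϕ) (hf : ContMDiff (𝓡 7) 𝓘(ℝ, ℝ) ∞ f) (hH : IsSmooth H) :
    (G.KillingSpinor ϕ H f ↔
      ∃ (Hp : Form Y 3) (τ₀ : Y → ℝ) (τ₁ : Form Y 1) (τ₂ : Form Y 2) (τ₃ : Form Y 3),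
        G.IsFluxDecomposition H f Hp ∧ G.IsTorsion τ₀ τ₁ τ₂ τ₃ ∧
        (∀ y, τ₀ y = -(15 / 14) * f y) ∧
        τ₁ = (1 / 2 : ℝ) • dFun ϕ ∧
        τ₂ = 0 ∧
        τ₃ = -Hp - (1 / 2 : ℝ) • G.contract (dFun ϕ) G.psi ∧
        G.hodge (k := 3) (q := 4) rfl τ₃ =
          -G.hodge (k := 3) (q := 4) rfl Hp
            + (1 / 2 : ℝ) • (fwedge (dFun ϕ) G.form : Form Y 4)) ∧
    (G.KillingSpinor ϕ H f → Bianchi H f → G.FluxEOM ϕ H) := by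
  have hgen := mainTheorem4_general G ϕ f H hϕ
  exact ⟨hgen.1, fun hK hB => hgen.2 hK hB.2⟩
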